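/- Let $G=(V,E;w)$ be a finite simple undirected graph with $V=\{0,\dots,n-1\}$, $n\ge 2$, and positive integer vertex weights $w_v\le U$. For $X\subseteq V$ and $S\subseteq X$ put $w(S)=\sum_{v\in S}w_v$ and $\Gamma_X(S)=\{v\in X:\ v \text{ is adjacent to some } u\in S\}$ (this set may meet $S$), and for $S\neq\emptyset$ let $\alpha_X(S)=w(\Gamma_X(S))/w(S)$. A maximal bottleneck of the induced subgraph $G[X]$ is a nonempty $B\subseteq X$ with $\alpha_X(B)=\min_{\emptyset\ne S\subseteq X}\alpha_X(S)$ and $\alpha_X(B')>\alpha_X(B)$ whenever $B\subsetneq B'\subseteq X$. A bottleneck decomposition of $G$ is a sequence $(B_1,C_1),\dots,(B_k,C_k)$ such that, with $V_1=V$, for each $i$ the set $B_i$ is a maximal bottleneck of $G[V_i]$, $C_i=\Gamma_{V_i}(B_i)$ and $V_{i+1}=V_i\setminus(B_i\cup C_i)$, and $V_{k+1}=\emptyset$. Then every such $G$ has exactly one bottleneck decomposition, and it can be computed in $O(n^6\log(nU))$ time. Precisely: there are a single word-RAM program and constants $K,c\in\mathbb N$, independent of $n,G,w,U$, such that for every such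 input, with $n$, the weights and the adjacency matrix in memory, the program halts after at most $K\,n^6\log(nU)$ steps, with $k$ and the $0$-$1$ indicator vectors of $B_1,\dots,B_k$ and of $C_1,\dots,C_k$ in memory. Here each arithmetic operation ($+$, truncated $-$, $\times$, integer division), comparison, memory access and control step costs one unit, and every number occurring in the computation, including addresses, is smaller than $(nU)^c$, i.e. has $O(\log(nU))$ bits. -/

import Mathlib

/-! ### Bottlenecks and the bottleneck decomposition

`w : V → ℕ` is the vertex weight function. For `X : Finset V`, the induced subgraph `G[X]` is
handled through `X` itself: its vertex subsets are the `S ⊆ X`, and neighbourhoods are cut with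
`X`. -/

section Bottleneck

variable {V : Type*}

/-- The weight `w(S) = ∑_{i ∈ S} w_i`. -/
def setWeight (w : V → ℕ) (S : Finset V) : ℕ := ∑ i ∈ S, w i

open Classical in
/-- The neighbourhood of `S` in `G[X]`: the vertices of `X` adjacent to some vertex of `S`.
It may meet `S`. -/
noncomputable def nbhdIn (G : SimpleGraph V) (X S : Finset V) : Finset V :=
  X.filter fun v => ∃ u ∈ S, G.Adj u v

/-- The `α`-ratio `w(Γ(S)) / w(S)` of `S` in `G[X]`. -/
noncomputable def alphaRatio (G : SimpleGraph V) (w : V → ℕ) (X S : Finset V) : ℚ :=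
  (setWeight w (nbhdIn G X S) : ℚ) / (setWeight w S : ℚ)

/-- `B` is a bottleneck of `G[X]`: a nonempty vertex subset of minimum `α`-ratio. -/
def IsBottleneck (G : SimpleGraph V) (w : V → ℕ) (X B : Finset V) : Prop :=
  B ⊆ X ∧ B.Nonempty ∧
    ∀ S : Finset V, S ⊆ X → S.Nonempty → alphaRatio G w X B ≤ alphaRatio G w X S

/-- `B` is a maximal bottleneck of `G[X]`: every proper superset has larger `α`-ratio. -/
def IsMaximalBottleneck (G : SimpleGraph V) (w : V → ℕ) (X B : Finset V) : Prop :=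
  IsBottleneck G w X B ∧
    ∀ B' : Finset V, B ⊂ B' → B' ⊆ X → alphaRatio G w X B < alphaRatio G w X B'

open Classical in
/-- `[(B₁, C₁), …, (B_k, C_k)]` is a bottleneck decomposition of `G[X]`: `B₁` is a maximal
bottleneck of `G[X]`, `C₁` is its neighbourhood in `G[X]`, and the remaining pairs form a
bottleneck decomposition of the subgraph induced on `X \ (B₁ ∪ C₁)`; the list ends exactly when
no vertex is left. -/
def IsBottleneckDecomposition (G : SimpleGraph V) (w : V → ℕ) :
    Finset V → List (Finset V × Finset V) → Prop
  | X, [] => X = ∅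
  | X, (B, C) :: L =>
      IsMaximalBottleneck G w X B ∧ C = nbhdIn G X B ∧
        IsBottleneckDecomposition G w (X \ (B ∪ C)) L

end Bottleneck

/-! ### A word RAM with a step count

Programs are built from assignments, array stores, sequencing, conditionals and loops. Memory
consists of scalar variables and arrays, all holding natural numbers. Every arithmetic operation,
comparison, numeral, memory access and branching step costs one unit. All semantics is relative to a
bound `W`: every number that is ever evaluated (array addresses and intermediate results
included) must be smaller than `W`, otherwise the execution is stuck. -/

namespace RAM

/-- Binary machine operations; `sub` is truncated, `div` rounds down, and the comparisons return
`1` or `0`. -/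
inductive BinOp where
  | add
  | sub
  | mul
  | div
  | lt
  | eq

/-- The value of a binary operation. -/
def BinOp.eval : BinOp → ℕ → ℕ → ℕ
  | .add, a, b => a + b
  | .sub, a, b => a - b
  | .mul, a, b => a * b
  | .div, a, b => a / b
  | .lt, a, b => if a < b then 1 else 0
  | .eq, a, b => if a = b then 1 else 0

/-- A memory state: `reg x` is the value of the scalar variable `x`, and `arr a i` is the `i`-th
cell of the array `a`. -/
structure State where
  reg : ℕ → ℕ
  arr : ℕ → ℕ → ℕ

/-- Assignment to a scalar variable. -/
def State.setReg (σ : State) (x v : ℕ) : State :=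
  { σ with reg := Function.update σ.reg x v }

/-- Assignment to an array cell. -/
def State.setArr (σ : State) (a i v : ℕ) : State :=
  { σ with arr := Function.update σ.arr a (Function.update (σ.arr a) i v) }

/-- Expressions: numerals, scalar variables, array reads and binary operations. The names of
variables and arrays are fixed in the program text; array indices are computed. -/
inductive Expr where
  | lit (k : ℕ)
  | var (x : ℕ)
  | read (a : ℕ) (i : Expr)
  | bin (op : BinOp) (e₁ e₂ : Expr)

/-- The value of an expression. -/
def Expr.eval (σ : State) : Expr → ℕ
  | .lit k => k
  | .var x => σ.reg x
  | .read a i => σ.arr a (i.eval σ)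
  | .bin op e₁ e₂ => op.eval (e₁.eval σ) (e₂.eval σ)

/-- The values of an expression and of all its subexpressions are smaller than `W`. -/
def Expr.Fits (W : ℕ) (σ : State) : Expr → Prop
  | .lit k => k < W
  | .var x => σ.reg x < W
  | .read a i => i.Fits W σ ∧ σ.arr a (i.eval σ) < W
  | .bin op e₁ e₂ => e₁.Fits W σ ∧ e₂.Fits W σ ∧ op.eval (e₁.eval σ) (e₂.eval σ) < W

/-- The cost of evaluating an expression: one unit for each node. -/
def Expr.cost : Expr → ℕ
  | .lit _ => 1
  | .var _ => 1
  | .read _ i => i.cost + 1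
  | .bin _ e₁ e₂ => e₁.cost + e₂.cost + 1

/-- Programs. -/
inductive Cmd where
  | skip
  | assign (x : ℕ) (e : Expr)
  | store (a : ℕ) (i e : Expr)
  | seq (c₁ c₂ : Cmd)
  | ite (e : Expr) (c₁ c₂ : Cmd)
  | loop (e : Expr) (c : Cmd)

/-- `Exec W c σ t σ'`: started in `σ`, the program `c` halts after exactly `t` steps in the
state `σ'`, and all numbers met on the way are smaller than `W`. A condition holds when its value
is nonzero, and `loop e c` is `while e do c`. -/
inductive Exec (W : ℕ) : Cmd → State → ℕ → State → Prop
  | skip (σ : State) : Exec W .skip σ 1 σ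
  | assign (σ : State) (x : ℕ) (e : Expr) (he : e.Fits W σ) :
      Exec W (.assign x e) σ (e.cost + 1) (σ.setReg x (e.eval σ))
  | store (σ : State) (a : ℕ) (i e : Expr) (hi : i.Fits W σ) (he : e.Fits W σ) :
      Exec W (.store a i e) σ (i.cost + e.cost + 1) (σ.setArr a (i.eval σ) (e.eval σ))
  | seq {c₁ c₂ : Cmd} {σ σ₁ σ₂ : State} {t₁ t₂ : ℕ}
      (h₁ : Exec W c₁ σ t₁ σ₁) (h₂ : Exec W c₂ σ₁ t₂ σ₂) :
      Exec W (.seq c₁ c₂) σ (t₁ + t₂) σ₂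
  | iteTrue {e : Expr} {c₁ c₂ : Cmd} {σ σ₁ : State} {t : ℕ}
      (he : e.Fits W σ) (hv : e.eval σ ≠ 0) (h : Exec W c₁ σ t σ₁) :
      Exec W (.ite e c₁ c₂) σ (e.cost + 1 + t) σ₁
  | iteFalse {e : Expr} {c₁ c₂ : Cmd} {σ σ₁ : State} {t : ℕ}
      (he : e.Fits W σ) (hv : e.eval σ = 0) (h : Exec W c₂ σ t σ₁) :
      Exec W (.ite e c₁ c₂) σ (e.cost + 1 + t) σ₁
  | loopTrue {e : Expr} {c : Cmd} {σ σ₁ σ₂ : State} {t₁ t₂ : ℕ}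
      (he : e.Fits W σ) (hv : e.eval σ ≠ 0)
      (h₁ : Exec W c σ t₁ σ₁) (h₂ : Exec W (.loop e c) σ₁ t₂ σ₂) :
      Exec W (.loop e c) σ (e.cost + 1 + t₁ + t₂) σ₂
  | loopFalse {e : Expr} {c : Cmd} {σ : State}
      (he : e.Fits W σ) (hv : e.eval σ = 0) :
      Exec W (.loop e c) σ (e.cost + 1) σ

end RAM

/-! ### Input and output -/

open Classical in
/-- The initial memory for a weighted graph on `{0, …, n-1}`: scalar `0` holds `n`, array `0`
holds the weights, array `1` holds the adjacency matrix row by row, and all else is zero. -/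
noncomputable def graphInput {n : ℕ} (G : SimpleGraph (Fin n)) (w : Fin n → ℕ) : RAM.State where
  reg := fun x => if x = 0 then n else 0
  arr := fun a i =>
    if a = 0 then (if h : i < n then w ⟨i, h⟩ else 0)
    else if a = 1 then
      (if ∃ u v : Fin n, G.Adj u v ∧ i = u.val * n + v.val then 1 else 0)
    else 0

/-- The memory `σ` displays the list `[(B₁, C₁), …, (B_k, C_k)]` of pairs of subsets of
`{0, …, n-1}`: scalar `1` holds `k`, and arrays `2` and `3` hold, row by row, the `0`-`1`
indicator vectors of the sets `B_i` and of the sets `C_i`. -/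
def DisplaysPairs {n : ℕ} (σ : RAM.State) (L : List (Finset (Fin n) × Finset (Fin n))) : Prop :=
  σ.reg 1 = L.length ∧
    ∀ (i : Fin L.length) (v : Fin n),
      σ.arr 2 (i.val * n + v.val) = (if v ∈ (L.get i).1 then 1 else 0) ∧
      σ.arr 3 (i.val * n + v.val) = (if v ∈ (L.get i).2 then 1 else 0)

/-! ### Reasoning about RAM programs -/

namespace RAM

/-! A maximal bottleneck is found by Dinkelbach's method. Given a nonempty `S`, with `p = w(Γ(S))`
and `q = w(S)`, let `L` be the largest minimizer of the Lagrangian `q·w(Γ(T)) - p·w(T)` over `T ⊆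
X`. The Lagrangian vanishes at `S`, so `L` has no larger ratio than `S`, and a strictly smaller one
unless `S` is already a bottleneck. If `S` is a bottleneck, then `L` is the only maximal bottleneck,
which gives uniqueness together with correctness. Since `w(Γ(·))` is submodular, a smaller
multiplier has a smaller largest minimizer (`IsMaxMinimizer.subset_of_lt`). Hence the sets strictly
shrink while the ratio drops, and `n + 1` steps from `S = X` suffice
(`isMaximalBottleneck_of_ratioSteps`).

The largest minimizer is a largest minimum cut in a bipartite double cover of `G[X]` with an added
sink (`IsBottleneckNet.isMaxMinimizer`). The source is left out: its arcs are saturated from the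
start and appear as excesses of the left copies. The cut is computed by a push-relabel method that
discharges all nodes in a fixed order, again and again. Pushes preserve the function `cut`. A
potential argument shows that on `m + 1` nodes `2(m+1)²` sweeps lead to a state that no sweep
changes (`stable_iterate_sweep`). In this state the nodes at the height cap form the largest minimum
cut (`Stable.cut_top_le`, `Stable.subset_top`).

With `N = 2n + 1` nodes a sweep costs `O(N²)`, so a Lagrangian minimization costs `O(N⁴)`. There are
`n` rounds of `n + 1` minimizations, in all `O(n⁶)` steps. The logarithm in the time bound is used
only through `log(nU) ≥ 1/2`.

The program is verified by Hoare-style rules for `Run`, which bounds time, memory contents and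
postcondition together. Only stored values have to be bounded, by some `M`; the intermediate values
of a small expression are then below a fixed power of `M`. -/

instance : Add Expr := ⟨.bin .add⟩
instance : Sub Expr := ⟨.bin .sub⟩
instance : Mul Expr := ⟨.bin .mul⟩
instance : Div Expr := ⟨.bin .div⟩

/-- The comparison `e₁ < e₂` as an expression. -/
def Expr.lt (e₁ e₂ : Expr) : Expr := .bin .lt e₁ e₂

/-- The comparison `e₁ = e₂` as an expression. -/
def Expr.eq (e₁ e₂ : Expr) : Expr := .bin .eq e₁ e₂

section Eval

variable (σ : State) (e₁ e₂ : Expr)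

@[simp] theorem Expr.eval_lit (k : ℕ) : (Expr.lit k).eval σ = k := rfl
@[simp] theorem Expr.eval_var (x : ℕ) : (Expr.var x).eval σ = σ.reg x := rfl
@[simp] theorem Expr.eval_read (a : ℕ) : (Expr.read a e₁).eval σ = σ.arr a (e₁.eval σ) := rfl
@[simp] theorem Expr.eval_add : (e₁ + e₂).eval σ = e₁.eval σ + e₂.eval σ := rfl
@[simp] theorem Expr.eval_sub : (e₁ - e₂).eval σ = e₁.eval σ - e₂.eval σ := rfl
@[simp] theorem Expr.eval_mul : (e₁ * e₂).eval σ = e₁.eval σ * e₂.eval σ := rfl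
@[simp] theorem Expr.eval_div : (e₁ / e₂).eval σ = e₁.eval σ / e₂.eval σ := rfl
@[simp] theorem Expr.eval_lt :
    (e₁.lt e₂).eval σ = if e₁.eval σ < e₂.eval σ then 1 else 0 := rfl
@[simp] theorem Expr.eval_eq :
    (e₁.eq e₂).eval σ = if e₁.eval σ = e₂.eval σ then 1 else 0 := rfl

end Eval

section StateLemmas

variable (σ : State)

@[simp] theorem State.arr_setReg (x v : ℕ) : (σ.setReg x v).arr = σ.arr := rfl
@[simp] theorem State.reg_setArr (a i v : ℕ) : (σ.setArr a i v).reg = σ.reg := rfl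
theorem State.reg_setReg (x v y : ℕ) :
    (σ.setReg x v).reg y = if y = x then v else σ.reg y := by
  simp [State.setReg, Function.update_apply]
theorem State.arr_setArr (a i v b j : ℕ) :
    (σ.setArr a i v).arr b j = if b = a ∧ j = i then v else σ.arr b j := by
  by_cases h : b = a
  · subst h; simp [State.setArr, Function.update_apply]
  · simp [State.setArr, h]

end StateLemmas

/-! ### Frame rule: memory that a program does not write -/

/-- The scalar variables that a program may write. -/
def Cmd.regs : Cmd → List ℕ
  | .skip => []
  | .assign x _ => [x]
  | .store _ _ _ => []
  | .seq c₁ c₂ => c₁.regs ++ c₂.regs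
  | .ite _ c₁ c₂ => c₁.regs ++ c₂.regs
  | .loop _ c => c.regs

/-- The arrays that a program may write. -/
def Cmd.arrs : Cmd → List ℕ
  | .skip => []
  | .assign _ _ => []
  | .store a _ _ => [a]
  | .seq c₁ c₂ => c₁.arrs ++ c₂.arrs
  | .ite _ c₁ c₂ => c₁.arrs ++ c₂.arrs
  | .loop _ c => c.arrs

/-- Two states agree on all the memory that `c` does not write. -/
def AgreesOff (c : Cmd) (σ σ' : State) : Prop :=
  (∀ x, x ∉ c.regs → σ'.reg x = σ.reg x) ∧ ∀ a, a ∉ c.arrs → σ'.arr a = σ.arr a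

theorem AgreesOff.refl (c : Cmd) (σ : State) : AgreesOff c σ σ :=
  ⟨fun _ _ => rfl, fun _ _ => rfl⟩

theorem AgreesOff.trans {c : Cmd} {σ₁ σ₂ σ₃ : State} (h : AgreesOff c σ₁ σ₂)
    (h' : AgreesOff c σ₂ σ₃) : AgreesOff c σ₁ σ₃ :=
  ⟨fun x hx => (h'.1 x hx).trans (h.1 x hx), fun a ha => (h'.2 a ha).trans (h.2 a ha)⟩

theorem AgreesOff.mono {c c' : Cmd} {σ₁ σ₂ : State} (h : AgreesOff c σ₁ σ₂)
    (hr : ∀ x ∈ c.regs, x ∈ c'.regs) (ha : ∀ x ∈ c.arrs, x ∈ c'.arrs) : AgreesOff c' σ₁ σ₂ :=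
  ⟨fun x hx => h.1 x fun hc => hx (hr x hc), fun a hx => h.2 a fun hc => hx (ha a hc)⟩

theorem AgreesOff.setReg {c : Cmd} {σ₁ σ₂ : State} (h : AgreesOff c σ₁ σ₂) {x : ℕ}
    (hx : x ∈ c.regs) (v : ℕ) : AgreesOff c σ₁ (σ₂.setReg x v) :=
  ⟨fun y hy => by
    rw [State.reg_setReg, if_neg (fun e : y = x => hy (e ▸ hx))]; exact h.1 y hy, h.2⟩

/-- The lists of written names are computed from the program text, so later uses of this frame
property reduce to `decide`. -/
theorem Exec.agreesOff {W : ℕ} {c : Cmd} {σ σ' : State} {t : ℕ} (h : Exec W c σ t σ') :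
    AgreesOff c σ σ' := by
  induction h with
  | skip σ => exact AgreesOff.refl _ _
  | assign σ x e he => exact (AgreesOff.refl _ _).setReg (by simp [Cmd.regs]) _
  | store σ a i e hi he =>
    refine ⟨fun x hx => rfl, fun b hb => ?_⟩
    have hb : b ≠ a := by simpa [Cmd.arrs] using hb
    funext j
    simp [State.arr_setArr, hb]
  | seq h₁ h₂ ih₁ ih₂ =>
    exact (ih₁.mono (by simp +contextual [Cmd.regs]) (by simp +contextual [Cmd.arrs])).trans
      (ih₂.mono (by simp +contextual [Cmd.regs]) (by simp +contextual [Cmd.arrs]))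
  | iteTrue he hv h ih =>
    exact ih.mono (by simp +contextual [Cmd.regs]) (by simp +contextual [Cmd.arrs])
  | iteFalse he hv h ih =>
    exact ih.mono (by simp +contextual [Cmd.regs]) (by simp +contextual [Cmd.arrs])
  | loopTrue he hv h₁ h₂ ih₁ ih₂ => exact AgreesOff.trans ⟨ih₁.1, ih₁.2⟩ ih₂
  | loopFalse he hv => exact AgreesOff.refl _ _

/-! ### Word size: small expressions over bounded memory -/

/-- Every memory cell holds a number at most `M`. -/
def Bdd (M : ℕ) (σ : State) : Prop :=
  (∀ x, σ.reg x ≤ M) ∧ ∀ a i, σ.arr a i ≤ M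

theorem Bdd.setReg {M : ℕ} {σ : State} (h : Bdd M σ) {x v : ℕ} (hv : v ≤ M) :
    Bdd M (σ.setReg x v) :=
  ⟨fun y => by rw [State.reg_setReg]; split_ifs; exacts [hv, h.1 y], h.2⟩

theorem Bdd.setArr {M : ℕ} {σ : State} (h : Bdd M σ) {a i v : ℕ} (hv : v ≤ M) :
    Bdd M (σ.setArr a i v) :=
  ⟨h.1, fun b j => by rw [State.arr_setArr]; split_ifs; exacts [hv, h.2 b j]⟩

/-- The numerals in an expression are at most `2`. -/
def Expr.litsLeTwo : Expr → Bool
  | .lit k => k ≤ 2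
  | .var _ => true
  | .read _ i => i.litsLeTwo
  | .bin _ e₁ e₂ => e₁.litsLeTwo && e₂.litsLeTwo

/-- An expression with at most `128` nodes and no numeral above `2`. -/
def Expr.small (e : Expr) : Bool := e.litsLeTwo && decide (e.cost ≤ 128)

/-- Addition decides the form of the exponent: `M^s + M^t ≤ 2 * M^s * M^t`, and the factor `2 ≤ M`
is paid by the node of the operation itself. -/
theorem BinOp.eval_le_pow (op : BinOp) {M a b s t : ℕ} (hM : 2 ≤ M) (ha : a ≤ M ^ s)
    (hb : b ≤ M ^ t) : op.eval a b ≤ M ^ (s + t + 1) := by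
  have hs : 1 ≤ M ^ s := Nat.one_le_pow _ _ (by omega)
  have ht : 1 ≤ M ^ t := Nat.one_le_pow _ _ (by omega)
  have hst : M ^ s * M ^ t * 2 ≤ M ^ (s + t + 1) := by
    rw [pow_succ, pow_add]; gcongr
  have hmul : M ^ s ≤ M ^ s * M ^ t := Nat.le_mul_of_pos_right _ ht
  have hmul' : M ^ t ≤ M ^ s * M ^ t := Nat.le_mul_of_pos_left _ hs
  cases op with
  | add => simp only [BinOp.eval]; omega
  | sub => simp only [BinOp.eval]; omega
  | mul =>
    have : a * b ≤ M ^ s * M ^ t := Nat.mul_le_mul ha hb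
    simp only [BinOp.eval]; omega
  | div =>
    have : a / b ≤ a := Nat.div_le_self _ _
    simp only [BinOp.eval]; omega
  | lt => simp only [BinOp.eval]; split_ifs <;> omega
  | eq => simp only [BinOp.eval]; split_ifs <;> omega

theorem Expr.eval_le_pow {M : ℕ} {σ : State} (hM : 2 ≤ M) (hσ : Bdd M σ) (e : Expr)
    (he : e.litsLeTwo = true) : e.eval σ ≤ M ^ e.cost := by
  induction e with
  | lit k =>
    simp only [Expr.litsLeTwo, decide_eq_true_eq] at he
    simp [Expr.cost]; omega
  | var x => simpa [Expr.cost] using hσ.1 x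
  | read a i ih =>
    exact (hσ.2 a _).trans (Nat.le_self_pow (by simp [Expr.cost]) M)
  | bin op e₁ e₂ ih₁ ih₂ =>
    simp only [Expr.litsLeTwo, Bool.and_eq_true] at he
    exact op.eval_le_pow hM (ih₁ he.1) (ih₂ he.2)

theorem Expr.fits_of_litsLeTwo {W M : ℕ} {σ : State} (hM : 2 ≤ M) (hσ : Bdd M σ) (e : Expr)
    (he : e.litsLeTwo = true) (hW : M ^ e.cost < W) : e.Fits W σ := by
  have key := e.eval_le_pow hM hσ he
  induction e with
  | lit k => exact key.trans_lt hW
  | var x => exact key.trans_lt hW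
  | read a i ih =>
    exact ⟨ih he ((Nat.pow_le_pow_right (by omega) (by simp [Expr.cost])).trans_lt hW)
      (i.eval_le_pow hM hσ he), key.trans_lt hW⟩
  | bin op e₁ e₂ ih₁ ih₂ =>
    have he' := he
    simp only [Expr.litsLeTwo, Bool.and_eq_true] at he'
    exact ⟨ih₁ he'.1 ((Nat.pow_le_pow_right (by omega) (by simp only [Expr.cost]; omega)).trans_lt hW)
        (e₁.eval_le_pow hM hσ he'.1),
      ih₂ he'.2 ((Nat.pow_le_pow_right (by omega) (by simp only [Expr.cost]; omega)).trans_lt hW)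
        (e₂.eval_le_pow hM hσ he'.2), key.trans_lt hW⟩

/-- The word bound `W` leaves room for small expressions over numbers up to `M`. -/
def Roomy (W M : ℕ) : Prop := 2 ≤ M ∧ M ^ 128 < W

/-- For a concrete expression `e.small = true` holds by `rfl`, so this disposes of every overflow
check in the verification. -/
theorem Roomy.fits {W M : ℕ} (h : Roomy W M) {σ : State} (hσ : Bdd M σ) {e : Expr}
    (he : e.small = true) : e.Fits W σ := by
  simp only [Expr.small, Bool.and_eq_true, decide_eq_true_eq] at he
  exact e.fits_of_litsLeTwo h.1 hσ he.1
    ((Nat.pow_le_pow_right (by have := h.1; omega) he.2).trans_lt h.2)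

/-- Started in `σ`, the program `c` halts after at most `T` steps in a state that satisfies `Q`
and holds only numbers up to `M`. -/
def Run (W M : ℕ) (c : Cmd) (σ : State) (T : ℕ) (Q : State → Prop) : Prop :=
  ∃ t σ', Exec W c σ t σ' ∧ t ≤ T ∧ Bdd M σ' ∧ Q σ'

/-! ### Proof rules for statements and loops -/

section Rules

variable {W M : ℕ} {σ : State} {Q : State → Prop}

theorem Run.mono {c : Cmd} {T T' : ℕ} {Q' : State → Prop} (h : Run W M c σ T Q) (hT : T ≤ T')
    (hQ : ∀ σ', Bdd M σ' → AgreesOff c σ σ' → Q σ' → Q' σ') : Run W M c σ T' Q' := by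
  obtain ⟨t, σ', he, ht, hb, hq⟩ := h
  exact ⟨t, σ', he, ht.trans hT, hb, hQ σ' hb he.agreesOff hq⟩

theorem run_assign (hW : Roomy W M) (hσ : Bdd M σ) {x : ℕ} {e : Expr} {T : ℕ}
    (hs : e.small = true) (hT : e.cost + 1 ≤ T) (hv : e.eval σ ≤ M)
    (hQ : Q (σ.setReg x (e.eval σ))) : Run W M (.assign x e) σ T Q :=
  ⟨_, _, .assign σ x e (hW.fits hσ hs), hT, hσ.setReg hv, hQ⟩

theorem run_store (hW : Roomy W M) (hσ : Bdd M σ) {a : ℕ} {i e : Expr} {T : ℕ}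
    (hi : i.small = true) (hs : e.small = true) (hT : i.cost + e.cost + 1 ≤ T)
    (hv : e.eval σ ≤ M) (hQ : Q (σ.setArr a (i.eval σ) (e.eval σ))) :
    Run W M (.store a i e) σ T Q :=
  ⟨_, _, .store σ a i e (hW.fits hσ hi) (hW.fits hσ hs), hT, hσ.setArr hv, hQ⟩

theorem run_seq {c₁ c₂ : Cmd} {T T₁ T₂ : ℕ} {Q₁ : State → Prop} (hT : T₁ + T₂ ≤ T)
    (h₁ : Run W M c₁ σ T₁ Q₁)
    (h₂ : ∀ σ₁, Bdd M σ₁ → AgreesOff c₁ σ σ₁ → Q₁ σ₁ → Run W M c₂ σ₁ T₂ Q) :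
    Run W M (.seq c₁ c₂) σ T Q := by
  obtain ⟨t₁, σ₁, he, ht, hb, hq⟩ := h₁
  obtain ⟨t₂, σ₂, he', ht', hb', hq'⟩ := h₂ σ₁ hb he.agreesOff hq
  exact ⟨_, _, .seq he he', by omega, hb', hq'⟩

/-- `for i < x do body`, where `i` and `x` are scalar variables. -/
def forLoop (i x : ℕ) (body : Cmd) : Cmd :=
  .seq (.assign i (.lit 0))
    (.loop ((Expr.var i).lt (.var x)) (.seq body (.assign i (.var i + .lit 1))))

theorem forLoop_regs (i x : ℕ) (body : Cmd) :
    (forLoop i x body).regs = i :: (body.regs ++ [i]) := rfl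

theorem forLoop_arrs (i x : ℕ) (body : Cmd) :
    (forLoop i x body).arrs = body.arrs := by
  simp [forLoop, Cmd.arrs]

/-- The invariant must survive any change of the counter (`hI`), since the counter moves between two
runs of the body. The overhead is 4 for the test and 4 for the increment in each round, and 2 + 4
for the initialization and the last test. -/
theorem run_forLoop (hW : Roomy W M) (hσ : Bdd M σ) {i x m T T' : ℕ} {body : Cmd}
    (I : ℕ → State → Prop) (hx : σ.reg x = m) (hxb : x ∉ (forLoop i x body).regs)
    (hib : i ∉ body.regs) (hT' : m * (T + 8) + 6 ≤ T')
    (hI : ∀ k τ v, I k τ → I k (τ.setReg i v)) (h0 : I 0 σ)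
    (hbody : ∀ k, k < m → ∀ τ, Bdd M τ → AgreesOff (forLoop i x body) σ τ → τ.reg i = k →
      I k τ → Run W M body τ T (I (k + 1))) :
    Run W M (forLoop i x body) σ T' (I m) := by
  have hmM : m ≤ M := hx ▸ hσ.1 x
  have hM : 2 ≤ M := hW.1
  have main : ∀ j k τ, k + j = m → Bdd M τ → AgreesOff (forLoop i x body) σ τ → τ.reg i = k →
      I k τ → Run W M (.loop ((Expr.var i).lt (.var x)) (.seq body (.assign i (.var i + .lit 1))))
        τ (j * (T + 8) + 4) (I m) := by
    intro j
    induction j with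
    | zero =>
      intro k τ hk hb ha hi hIk
      have hkm : k = m := by omega
      refine ⟨_, τ, .loopFalse (hW.fits hb rfl) ?_, by simp [Expr.cost, Expr.lt], hb, hkm ▸ hIk⟩
      simp [hi, ha.1 x hxb, hx, hkm]
    | succ j ih =>
      intro k τ hk hb ha hi hIk
      obtain ⟨t₁, τ₁, he₁, ht₁, hb₁, hq₁⟩ := hbody k (by omega) τ hb ha hi hIk
      have ha₁ : AgreesOff (forLoop i x body) σ τ₁ :=
        ha.trans (he₁.agreesOff.mono (by simp +contextual [forLoop_regs])
          (by simp +contextual [forLoop_arrs]))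
      have hi₁ : τ₁.reg i = k := (he₁.agreesOff.1 i hib).trans hi
      have hv : (Expr.var i + .lit 1).eval τ₁ = k + 1 := by simp [hi₁]
      obtain ⟨t₂, τ₂, he₂, ht₂, hb₂, hq₂⟩ := ih (k + 1)
        (τ₁.setReg i ((Expr.var i + .lit 1).eval τ₁)) (by omega)
        (hb₁.setReg (by rw [hv]; omega))
        (ha₁.setReg (by simp [forLoop_regs]) _) (by rw [hv]; simp [State.reg_setReg])
        (hI _ _ _ hq₁)
      refine ⟨_, τ₂, .loopTrue (hW.fits hb rfl) ?_
        (.seq he₁ (.assign _ _ _ (hW.fits hb₁ rfl))) he₂, ?_, hb₂, hq₂⟩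
      · simp [hi, ha.1 x hxb, hx]; omega
      · have hc₁ : (Expr.var i + Expr.lit 1).cost = 3 := rfl
        have hc₂ : ((Expr.var i).lt (.var x)).cost = 3 := rfl
        rw [hc₁, hc₂, Nat.succ_mul]; omega
  refine run_seq (T₁ := 2) (T₂ := m * (T + 8) + 4)
    (Q₁ := fun τ => τ = σ.setReg i 0) (by omega) ?_ ?_
  · exact run_assign hW hσ rfl le_rfl (Nat.zero_le _) rfl
  · rintro τ hb - rfl
    refine main m 0 _ (by omega) hb ((AgreesOff.refl _ _).setReg (by simp [forLoop_regs]) 0)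
      (by simp [State.reg_setReg]) (hI _ _ _ h0)

/-- A loop that fills `m` cells of an array. -/
theorem run_fill (hW : Roomy W M) (hσ : Bdd M σ) {i x m a T : ℕ} {idx e : Expr} (h val : ℕ → ℕ)
    (hx : σ.reg x = m) (hxi : x ≠ i) (hidx : idx.small = true) (he : e.small = true)
    (hT : m * 300 + 6 ≤ T) (hinj : ∀ k < m, ∀ l < m, h k = h l → k = l)
    (hval : ∀ k < m, val k ≤ M)
    (hev : ∀ k < m, ∀ τ : State, (∀ y, y ≠ i → τ.reg y = σ.reg y) → τ.reg i = k →
      (∀ b, b ≠ a → τ.arr b = σ.arr b) → τ.arr a (h k) = σ.arr a (h k) →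
      idx.eval τ = h k ∧ (idx.eval τ = h k → e.eval τ = val k)) :
    Run W M (forLoop i x (.store a idx e)) σ T (fun τ =>
      (∀ k < m, τ.arr a (h k) = val k) ∧
        ∀ j, (∀ k < m, h k ≠ j) → τ.arr a j = σ.arr a j) := by
  -- Two small expressions of cost at most 128 and the store itself; with the loop overhead of 8
  -- this stays below 300.
  have hcost : idx.cost + e.cost + 1 ≤ 257 := by
    simp only [Expr.small, Bool.and_eq_true, decide_eq_true_eq] at hidx he
    omega
  refine run_forLoop (T := 257) hW hσ (fun k τ => (∀ l < k, τ.arr a (h l) = val l) ∧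
      ∀ j, (∀ l < k, h l ≠ j) → τ.arr a j = σ.arr a j) hx
      (by simp [forLoop_regs, Cmd.regs, hxi]) (by simp [Cmd.regs])
      (le_trans (Nat.add_le_add_right (Nat.mul_le_mul_left m (by norm_num)) 6) hT)
      (fun _ _ _ h => h) (by simp) ?_
  intro k hk τ hb hag hi hIk
  have hreg : ∀ y, y ≠ i → τ.reg y = σ.reg y := fun y hy =>
    hag.1 y (by simp [forLoop_regs, Cmd.regs, hy])
  have harr : ∀ b, b ≠ a → τ.arr b = σ.arr b := fun b hb' =>
    hag.2 b (by simp [forLoop_arrs, Cmd.arrs, hb'])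
  -- By injectivity of `h` a cell is untouched until its own turn, so an array can be updated in
  -- place.
  have hk0 : τ.arr a (h k) = σ.arr a (h k) :=
    hIk.2 _ fun l hl hc => absurd (hinj l (by omega) k hk hc) (by omega)
  obtain ⟨h₁, h₂⟩ := hev k hk τ hreg hi harr hk0
  have h₂ := h₂ h₁
  refine run_store hW hb hidx he hcost (h₂ ▸ hval k hk) ?_
  rw [h₁, h₂]
  constructor
  · intro l hl
    rw [State.arr_setArr]
    by_cases hlk : l = k
    · simp [hlk]
    · rw [if_neg, hIk.1 l (by omega)]
      exact fun hc => hlk (hinj l (by omega) k hk hc.2)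
  · intro j hj
    rw [State.arr_setArr, if_neg, hIk.2 j fun l hl => hj l (by omega)]
    exact fun hc => hj k (by omega) hc.2.symm

/-- A loop that adds up `m` numbers in a scalar variable. -/
theorem run_sum (hW : Roomy W M) (hσ : Bdd M σ) {i x m y T : ℕ} {e : Expr} (val : ℕ → ℕ)
    (hx : σ.reg x = m) (hxi : x ≠ i) (hxy : x ≠ y) (hiy : i ≠ y)
    (he : (Expr.var y + e).small = true)
    (hT : m * 300 + 10 ≤ T) (hval : ∑ k ∈ Finset.range m, val k ≤ M)
    (hev : ∀ k < m, ∀ τ : State, (∀ z, z ≠ i → z ≠ y → τ.reg z = σ.reg z) → τ.reg i = k →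
      τ.arr = σ.arr → e.eval τ = val k) :
    Run W M (.seq (.assign y (.lit 0)) (forLoop i x (.assign y (.var y + e)))) σ T (fun τ =>
      τ.reg y = ∑ k ∈ Finset.range m, val k) := by
  have hcost : (Expr.var y + e).cost + 1 ≤ 129 := by
    simp only [Expr.small, Bool.and_eq_true, decide_eq_true_eq] at he
    omega
  refine run_seq (T₁ := 2) (T₂ := m * 300 + 6) (Q₁ := fun τ => τ = σ.setReg y 0)
    (by omega) (run_assign hW hσ rfl le_rfl (Nat.zero_le _) rfl) ?_
  rintro _ hb - rfl
  refine run_forLoop (T := 129) hW hb (fun k τ => τ.reg y = ∑ l ∈ Finset.range k, val l)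
    (by simp [State.reg_setReg, hxy, hx])
    (by simp [forLoop_regs, Cmd.regs, hxi, hxy]) (by simp [Cmd.regs, hiy]) (by omega)
    (fun k τ v h => by simpa [State.reg_setReg, hiy.symm] using h) (by simp [State.reg_setReg]) ?_
  intro k hk τ hb' hag hi hIk
  have h₁ : e.eval τ = val k := by
    refine hev k hk τ (fun z hz hz' => ?_) hi ?_
    · rw [hag.1 z (by simp [forLoop_regs, Cmd.regs, hz, hz'])]
      simp [State.reg_setReg, hz']
    · funext b
      exact hag.2 b (by simp [forLoop_arrs, Cmd.arrs])
  have h₂ : (Expr.var y + e).eval τ = ∑ l ∈ Finset.range (k + 1), val l := by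
    rw [Finset.sum_range_succ, Expr.eval_add, h₁, Expr.eval_var, hIk]
  refine run_assign hW hb' he hcost ?_ ?_
  · rw [h₂]
    refine le_trans (Finset.sum_le_sum_of_subset ?_) hval
    exact Finset.range_mono (by omega)
  · rw [h₂]; simp [State.reg_setReg]

end Rules

end RAM

/-! ### Push-relabel by sweeps

The network has the nodes `0, …, m`, the node `m` being the sink. Heights are capped at `m + 1`. -/

/-- A preflow: residual capacities, excesses and heights. -/
@[ext] structure Net where
  r : ℕ → ℕ → ℕ
  e : ℕ → ℕ
  d : ℕ → ℕ

namespace Net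

variable (m : ℕ)

/-- The amount pushed from `a` to `b`. -/
def pushAmount (s : Net) (a b : ℕ) : ℕ :=
  if s.d a = s.d b + 1 ∧ s.d a < m + 1 then min (s.e a) (s.r a b) else 0

/-- Push from `a` to `b`. -/
def push (s : Net) (a b : ℕ) : Net where
  r x y := if x = b ∧ y = a then s.r b a + s.pushAmount m a b
    else if x = a ∧ y = b then s.r a b - s.pushAmount m a b else s.r x y
  e x := if x = b then s.e b + s.pushAmount m a b
    else if x = a then s.e a - s.pushAmount m a b else s.e x
  d := s.d

/-- Push from `a` to `0, …, k - 1` in this order. -/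
def pushes (s : Net) (a : ℕ) : ℕ → Net
  | 0 => s
  | k + 1 => (pushes s a k).push m a k

/-- The arc from `a` to `b` is residual and leads one level down. -/
def Admissible (s : Net) (a b : ℕ) : Prop := 0 < s.r a b ∧ s.d a = s.d b + 1

open Classical in
/-- Raise `a` by one level if it is below the cap and has no admissible arc. -/
noncomputable def relabel (s : Net) (a : ℕ) : Net where
  r := s.r
  e := s.e
  d x := if x = a ∧ s.d a < m + 1 ∧ ¬ ∃ b < m + 1, s.Admissible a b then s.d x + 1 else s.d x

/-- Push along all arcs from `a`, then relabel. -/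
noncomputable def discharge (s : Net) (a : ℕ) : Net := (s.pushes m a (m + 1)).relabel m a

/-- Discharge the nodes `0, …, k - 1` in this order. -/
noncomputable def sweepTo (s : Net) : ℕ → Net
  | 0 => s
  | k + 1 => (sweepTo s k).discharge m k

/-- Discharge all nodes but the sink. -/
noncomputable def sweep (s : Net) : Net := s.sweepTo m m

variable {m}

theorem pushAmount_self (s : Net) (a : ℕ) : s.pushAmount m a a = 0 := by
  simp [pushAmount]

theorem pushAmount_le_e (s : Net) (a b : ℕ) : s.pushAmount m a b ≤ s.e a := by
  unfold pushAmount; split_ifs <;> simp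

theorem pushAmount_le_r (s : Net) (a b : ℕ) : s.pushAmount m a b ≤ s.r a b := by
  unfold pushAmount; split_ifs <;> simp

theorem of_pushAmount_pos {s : Net} {a b : ℕ} (h : 0 < s.pushAmount m a b) :
    s.d a = s.d b + 1 ∧ s.d a < m + 1 ∧ 0 < s.e a ∧ 0 < s.r a b := by
  unfold pushAmount at h
  split_ifs at h with h'
  · exact ⟨h'.1, h'.2, by omega, by omega⟩
  · omega

theorem push_eq_self {s : Net} {a b : ℕ} (h : s.pushAmount m a b = 0) : s.push m a b = s := by
  ext x y
  · simp only [push, h]; grind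
  · simp only [push, h]; grind
  · rfl

theorem push_r_self {s : Net} {a b : ℕ} : (s.push m a b).r a b = s.r a b - s.pushAmount m a b := by
  by_cases h : a = b
  · subst h; simp [push, pushAmount_self]
  · simp [push, h]

theorem push_e_self {s : Net} {a b : ℕ} : (s.push m a b).e a = s.e a - s.pushAmount m a b := by
  by_cases h : a = b
  · subst h; simp [push, pushAmount_self]
  · simp [push, h]

theorem le_push_r {s : Net} {a b x y : ℕ} (hx : x ≠ a) : s.r x y ≤ (s.push m a b).r x y := by
  simp only [push]; grind

theorem push_r_of_ne {s : Net} {a b y : ℕ} (hy : y ≠ b) : (s.push m a b).r a y = s.r a y := by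
  by_cases h : a = b
  · subst h; simp [push_eq_self, pushAmount_self]
  · simp [push, h, hy]

/-! #### Invariants -/

/-- Residual arcs go down at most one level, the sink has height zero, and heights are capped. -/
structure Valid (m : ℕ) (s : Net) : Prop where
  arc : ∀ a ≤ m, ∀ b ≤ m, 0 < s.r a b → s.d a ≤ s.d b + 1
  sink : s.d m = 0
  le : ∀ a ≤ m, s.d a ≤ m + 1

/-- The only arc that can become residual is the reverse one, and it leads one level up. -/
theorem Valid.push {s : Net} (h : Valid m s) (a b : ℕ) : Valid m (s.push m a b) := by
  refine ⟨fun x hx y hy hr => ?_, h.sink, h.le⟩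
  rcases Nat.eq_zero_or_pos (s.pushAmount m a b) with h0 | h0
  · rw [push_eq_self h0] at hr ⊢; exact h.arc x hx y hy hr
  · have := (of_pushAmount_pos h0).1
    simp only [Net.push] at hr ⊢
    split_ifs at hr with h1 h2
    · obtain ⟨rfl, rfl⟩ := h1; omega
    · obtain ⟨rfl, rfl⟩ := h2; omega
    · exact h.arc x hx y hy hr

theorem Valid.pushes {s : Net} (h : Valid m s) (a k : ℕ) : Valid m (s.pushes m a k) := by
  induction k with
  | zero => exact h
  | succ k ih => exact ih.push a k

/-- Without an admissible arc, every residual arc from `a` ends at least as high as `a`, so there is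
room for one level. -/
theorem Valid.relabel {s : Net} (h : Valid m s) {a : ℕ} (ha : a < m) :
    Valid m (s.relabel m a) := by
  refine ⟨fun x hx y hy hr => ?_, ?_, fun x hx => ?_⟩
  · have h1 := h.arc x hx y hy hr
    simp only [Net.relabel] at hr ⊢
    by_cases hc : s.d a < m + 1 ∧ ¬ ∃ b < m + 1, s.Admissible a b
    · by_cases hxa : x = a
      · subst hxa
        have : s.d x ≠ s.d y + 1 := fun hd => hc.2 ⟨y, by omega, hr, hd⟩
        simp only [hc, not_false_eq_true, and_self, if_true]
        split_ifs <;> omega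
      · simp only [hxa, false_and, if_false]; split_ifs <;> omega
    · simp only [hc, and_false, if_false]; exact h1
  · simp only [Net.relabel]; rw [if_neg (by omega)]; exact h.sink
  · have := h.le x hx
    simp only [Net.relabel]; split_ifs with hc
    · obtain ⟨rfl, hc, -⟩ := hc; omega
    · exact this

theorem Valid.discharge {s : Net} (h : Valid m s) {a : ℕ} (ha : a < m) :
    Valid m (s.discharge m a) := (h.pushes a _).relabel ha

theorem Valid.sweepTo {s : Net} (h : Valid m s) {k : ℕ} (hk : k ≤ m) :
    Valid m (s.sweepTo m k) := by
  induction k with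
  | zero => exact h
  | succ k ih => exact (ih (by omega)).discharge hk

theorem Valid.sweep {s : Net} (h : Valid m s) : Valid m (s.sweep m) := h.sweepTo le_rfl

/-- The residual capacity leaving `A` minus the excess inside `A`. -/
def cut (m : ℕ) (s : Net) (A : Finset ℕ) : ℤ :=
  ∑ x ∈ Finset.range (m + 1), ∑ y ∈ Finset.range (m + 1),
      (if x ∈ A ∧ y ∉ A then (s.r x y : ℤ) else 0) -
    ∑ x ∈ Finset.range (m + 1), (if x ∈ A then (s.e x : ℤ) else 0)

/-- A push across the boundary of `A` changes the residual capacity leaving `A` and the excess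
inside `A` by the same amount; any other push changes neither. Cuts of the final network are
therefore cuts of the initial one. -/
theorem cut_push {s : Net} {a b : ℕ} (ha : a ≤ m) (hb : b ≤ m) (A : Finset ℕ) :
    cut m (s.push m a b) A = cut m s A := by
  set δ := s.pushAmount m a b with hδ
  have hr : ∀ x y, ((s.push m a b).r x y : ℤ) = s.r x y +
      ((if x = b then (if y = a then (δ : ℤ) else 0) else 0) -
        (if x = a then (if y = b then (δ : ℤ) else 0) else 0)) := by
    intro x y
    have h1 := s.pushAmount_le_r (m := m) a b
    by_cases hab : a = b
    · subst hab
      simp [push_eq_self, pushAmount_self]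
    · simp only [Net.push]
      by_cases h1 : x = b <;> by_cases h2 : y = a <;> by_cases h3 : x = a <;>
        by_cases h4 : y = b <;> (simp_all; try omega)
  have he : ∀ x, ((s.push m a b).e x : ℤ) = s.e x +
      ((if x = b then (δ : ℤ) else 0) - (if x = a then (δ : ℤ) else 0)) := by
    intro x
    have h1 := s.pushAmount_le_e (m := m) a b
    by_cases hab : a = b
    · subst hab
      simp [push_eq_self, pushAmount_self]
    · simp only [Net.push]
      by_cases h1 : x = b <;> by_cases h3 : x = a <;> (simp_all; try omega)
  have h1 : ∀ x y, (if x ∈ A ∧ y ∉ A then ((s.push m a b).r x y : ℤ) else 0) =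
      (if x ∈ A ∧ y ∉ A then (s.r x y : ℤ) else 0) +
        ((if x = b then (if y = a then (if b ∈ A ∧ a ∉ A then (δ : ℤ) else 0) else 0) else 0) -
        (if x = a then (if y = b then (if a ∈ A ∧ b ∉ A then (δ : ℤ) else 0) else 0) else 0)) := by
    intro x y; rw [hr]; grind
  have h2 : ∀ x, (if x ∈ A then ((s.push m a b).e x : ℤ) else 0) =
      (if x ∈ A then (s.e x : ℤ) else 0) +
        ((if x = b then (if b ∈ A then (δ : ℤ) else 0) else 0) -
          (if x = a then (if a ∈ A then (δ : ℤ) else 0) else 0)) := by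
    intro x; rw [he]; grind
  have ha' : a < m + 1 := by omega
  have hb' : b < m + 1 := by omega
  unfold cut
  simp only [h1, h2, Finset.sum_add_distrib, Finset.sum_sub_distrib, Finset.sum_ite_eq',
    Finset.mem_range, ha', hb', if_true]
  have h3 : ∀ (p q : ℕ) (c : ℤ), p < m + 1 → q < m + 1 →
      ∑ x ∈ Finset.range (m + 1), ∑ y ∈ Finset.range (m + 1),
        (if x = p then (if y = q then c else 0) else 0) = c := by
    intro p q c hp hq
    rw [Finset.sum_eq_single p]
    · simp; omega
    · intro x _ hx; simp [hx]
    · intro h; simp at h; omega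
  rw [h3 b a _ hb' ha', h3 a b _ ha' hb']
  grind

theorem cut_pushes {s : Net} {a k : ℕ} (ha : a ≤ m) (hk : k ≤ m + 1) (A : Finset ℕ) :
    cut m (s.pushes m a k) A = cut m s A := by
  induction k with
  | zero => rfl
  | succ k ih => exact (cut_push ha (by omega) A).trans (ih (by omega))

theorem cut_sweepTo {s : Net} {k : ℕ} (hk : k ≤ m) (A : Finset ℕ) :
    cut m (s.sweepTo m k) A = cut m s A := by
  induction k with
  | zero => rfl
  | succ k ih => exact (cut_pushes (by omega) le_rfl A).trans (ih (by omega))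

/-- Bounds on the numbers in a network. -/
structure Within (m E R : ℕ) (s : Net) : Prop where
  e : ∑ a ∈ Finset.range (m + 1), s.e a ≤ E
  r : ∀ a ≤ m, ∀ b ≤ m, s.r a b + s.r b a ≤ R

theorem Within.e_le {m E R : ℕ} {s : Net} (h : Within m E R s) {a : ℕ} (ha : a ≤ m) :
    s.e a ≤ E :=
  (Finset.single_le_sum (fun _ _ => Nat.zero_le _) (Finset.mem_range.2 (by omega))).trans h.e

/-- No arc leaves the set of all nodes, so its cut value is minus the total excess, and the
invariance of `cut` is conservation of excess. Capacity is only moved between an arc and its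
reverse. -/
theorem Within.push {E R : ℕ} {s : Net} (h : Within m E R s) {a b : ℕ} (ha : a ≤ m) (hb : b ≤ m) :
    Within m E R (s.push m a b) := by
  constructor
  · have h1 := cut_push (s := s) ha hb (Finset.range (m + 1))
    have h2 : ∀ t : Net, cut m t (Finset.range (m + 1)) =
        -((∑ x ∈ Finset.range (m + 1), t.e x : ℕ) : ℤ) := by
      intro t
      unfold cut
      rw [Finset.sum_eq_zero, zero_sub, Finset.sum_congr rfl fun x hx => if_pos hx]
      · push_cast; rfl
      · intro x _
        exact Finset.sum_eq_zero fun y hy => by simp [hy]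
    rw [h2, h2] at h1
    have := h.e
    omega
  · intro x hx y hy
    have h1 := h.r x hx y hy
    have h2 := s.pushAmount_le_r (m := m) a b
    by_cases hab : a = b
    · subst hab; rwa [push_eq_self (pushAmount_self s a)]
    · simp only [Net.push]; grind

theorem Within.pushes {E R : ℕ} {s : Net} (h : Within m E R s) {a k : ℕ} (ha : a ≤ m)
    (hk : k ≤ m + 1) : Within m E R (s.pushes m a k) := by
  induction k with
  | zero => exact h
  | succ k ih => exact (ih (by omega)).push ha (by omega)

theorem Within.sweepTo {E R : ℕ} {s : Net} (h : Within m E R s) {k : ℕ} (hk : k ≤ m) :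
    Within m E R (s.sweepTo m k) := by
  induction k with
  | zero => exact h
  | succ k ih =>
    have := (ih (by omega)).pushes (a := k) (by omega) le_rfl
    exact ⟨this.e, this.r⟩

/-! #### Termination -/

/-- `a` is below the cap and has an excess. -/
def Active (m : ℕ) (s : Net) (a : ℕ) : Prop := 0 < s.e a ∧ s.d a < m + 1

/-- All active nodes are on the levels below `h`. -/
def ActiveBelow (m : ℕ) (s : Net) (h : ℕ) : Prop := ∀ a < m, Active m s a → s.d a < h

/-- The sum of the heights. -/
def heightSum (m : ℕ) (s : Net) : ℕ := ∑ a ∈ Finset.range m, s.d a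

theorem pushes_d (s : Net) (a k : ℕ) : (s.pushes m a k).d = s.d := by
  induction k with
  | zero => rfl
  | succ k ih => exact ih

theorem le_pushes_r {s : Net} {a x y : ℕ} (hx : x ≠ a) (k : ℕ) :
    s.r x y ≤ (s.pushes m a k).r x y := by
  induction k with
  | zero => exact le_rfl
  | succ k ih => exact ih.trans (le_push_r hx)

/-- A node that becomes active by a push lies one level below a node that was active. -/
theorem ActiveBelow.push {s : Net} {h a : ℕ} (hs : ActiveBelow m s h) (ha : a < m) (b : ℕ) :
    ActiveBelow m (s.push m a b) h := by
  intro x hx hact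
  rcases Nat.eq_zero_or_pos (s.pushAmount m a b) with h0 | h0
  · rw [push_eq_self h0] at hact ⊢; exact hs x hx hact
  · obtain ⟨h1, h2, h3, -⟩ := of_pushAmount_pos h0
    have ha' := hs a ha ⟨h3, h2⟩
    have hx' := hs x hx
    simp only [Active, Net.push] at hact hx' ⊢
    grind

theorem ActiveBelow.pushes {s : Net} {h a : ℕ} (hs : ActiveBelow m s h) (ha : a < m) (k : ℕ) :
    ActiveBelow m (s.pushes m a k) h := by
  induction k with
  | zero => exact hs
  | succ k ih => exact ih.push ha k

/-- An arc that is still admissible after its turn was not saturated, so the push along it used up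
the excess of `a`; later pushes from `a` cannot restore it. -/
theorem pushes_e_eq_zero {s : Net} {a k b : ℕ} (hb : b < k) (ha : s.d a < m + 1)
    (hadm : (s.pushes m a k).Admissible a b) : (s.pushes m a k).e a = 0 := by
  induction k with
  | zero => omega
  | succ k ih =>
    obtain ⟨hr, hd⟩ := hadm
    rw [pushes_d] at hd
    simp only [pushes] at hr ⊢
    by_cases hbk : b = k
    · subst hbk
      rw [push_r_self] at hr
      rw [push_e_self]
      have : (s.pushes m a b).pushAmount m a b =
          min ((s.pushes m a b).e a) ((s.pushes m a b).r a b) := by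
        rw [pushAmount, if_pos]; rw [pushes_d]; exact ⟨hd, ha⟩
      omega
    · rw [push_r_of_ne hbk] at hr
      have h0 := ih (by omega) ⟨hr, by rw [pushes_d]; exact hd⟩
      rw [push_e_self]; omega

theorem pushes_e_pos {s : Net} {a k x : ℕ} (hxa : x ≠ a) (hx : 0 < (s.pushes m a k).e x) :
    0 < s.e x ∨ (s.d a = s.d x + 1 ∧ s.d a < m + 1 ∧ 0 < s.e a) := by
  have hmono : ∀ k, (s.pushes m a k).e a ≤ s.e a := by
    intro k
    induction k with
    | zero => exact le_rfl
    | succ k ih => simp only [pushes]; rw [push_e_self]; omega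
  induction k with
  | zero => exact Or.inl hx
  | succ k ih =>
    simp only [pushes] at hx
    rcases Nat.eq_zero_or_pos ((s.pushes m a k).pushAmount m a k) with h0 | h0
    · rw [push_eq_self h0] at hx; exact ih hx
    · obtain ⟨h1, h2, h3, -⟩ := of_pushAmount_pos h0
      rw [pushes_d] at h1 h2
      have := hmono k
      by_cases hxk : x = k
      · subst hxk; exact Or.inr ⟨h1, h2, by omega⟩
      · exact ih (by simpa [Net.push, hxk, hxa] using hx)

theorem le_discharge_d (s : Net) (a x : ℕ) : s.d x ≤ (s.discharge m a).d x := by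
  simp only [discharge, relabel, pushes_d]; split_ifs <;> omega

theorem le_sweepTo_d (s : Net) (x : ℕ) {k l : ℕ} (h : k ≤ l) :
    (s.sweepTo m k).d x ≤ (s.sweepTo m l).d x := by
  induction l, h using Nat.le_induction with
  | base => exact le_rfl
  | succ l hl ih => exact ih.trans (le_discharge_d _ _ _)

/-- Pushes do not raise the highest active level, and a relabel raises it by at most one while
raising the height sum by one. -/
theorem ActiveBelow.discharge {s : Net} {h a : ℕ} (hs : ActiveBelow m s h) (ha : a < m) :
    heightSum m s ≤ heightSum m (s.discharge m a) ∧ ActiveBelow m (s.discharge m a)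
      (h + (heightSum m (s.discharge m a) - heightSum m s)) := by
  have hp := hs.pushes ha (m + 1)
  have hle : heightSum m s ≤ heightSum m (s.discharge m a) :=
    Finset.sum_le_sum fun x _ => le_discharge_d s a x
  refine ⟨hle, fun x hx hact => ?_⟩
  by_cases hxd : (s.discharge m a).d x = s.d x
  · have := hp x hx ⟨hact.1, by have := hact.2; rw [hxd] at this; rwa [pushes_d]⟩
    rw [pushes_d] at this
    omega
  · have hlt : heightSum m s < heightSum m (s.discharge m a) :=
      Finset.sum_lt_sum (fun y _ => le_discharge_d s a y)
        ⟨x, Finset.mem_range.2 hx, lt_of_le_of_ne (le_discharge_d s a x) (Ne.symm hxd)⟩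
    have hd : (s.discharge m a).d x ≤ s.d x + 1 := by
      simp only [Net.discharge, relabel, pushes_d]; split_ifs <;> omega
    have := hp x hx ⟨hact.1, by rw [pushes_d]; have := hact.2; have := le_discharge_d (m := m) s a x; omega⟩
    rw [pushes_d] at this
    omega

theorem ActiveBelow.sweepTo {s : Net} {h k : ℕ} (hs : ActiveBelow m s h) (hk : k ≤ m) :
    heightSum m s ≤ heightSum m (s.sweepTo m k) ∧ ActiveBelow m (s.sweepTo m k)
      (h + (heightSum m (s.sweepTo m k) - heightSum m s)) := by
  induction k with
  | zero => exact ⟨le_rfl, by simpa [Net.sweepTo] using hs⟩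
  | succ k ih =>
    obtain ⟨h1, h2⟩ := ih (by omega)
    obtain ⟨h3, h4⟩ := h2.discharge (a := k) hk
    refine ⟨h1.trans h3, fun x hx hact => ?_⟩
    have := h4 x hx hact
    simp only [Net.sweepTo] at *
    omega

/-- No node below the cap has an excess, and each has an admissible arc. -/
structure Stable (m : ℕ) (s : Net) : Prop where
  e : ∀ a < m, s.d a < m + 1 → s.e a = 0
  arc : ∀ a < m, s.d a < m + 1 → ∃ b < m + 1, s.Admissible a b

theorem Stable.discharge {s : Net} (h : Stable m s) {a : ℕ} (ha : a < m) :
    s.discharge m a = s := by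
  have hp : ∀ k, s.pushes m a k = s := by
    intro k
    induction k with
    | zero => rfl
    | succ k ih =>
      rw [pushes, ih]
      refine push_eq_self ?_
      by_contra h0
      obtain ⟨-, h2, h3, -⟩ := of_pushAmount_pos (Nat.pos_of_ne_zero h0)
      have := h.e a ha h2
      omega
  rw [Net.discharge, hp]
  ext x y
  · rfl
  · rfl
  · simp only [relabel]
    rw [if_neg]
    rintro ⟨-, h2, h3⟩
    exact h3 (h.arc a ha h2)

theorem Stable.sweep {s : Net} (h : Stable m s) : s.sweep m = s := by
  have : ∀ k ≤ m, s.sweepTo m k = s := by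
    intro k
    induction k with
    | zero => intro _; rfl
    | succ k ih => intro hk; rw [sweepTo, ih (by omega), h.discharge (by omega)]
  exact this m le_rfl

/-- A sweep that changes no height lowers the highest active level. -/
theorem sweepTo_of_d_eq {s : Net} {h k : ℕ} (hs : ActiveBelow m s h) (hk : k ≤ m)
    (hd : ∀ a < m, (s.sweepTo m k).d a = s.d a) :
    ActiveBelow m (s.sweepTo m k) h ∧
      (∀ a < k, Active m (s.sweepTo m k) a → s.d a + 1 < h) ∧
      ∀ a < k, s.d a < m + 1 → ∃ b < m + 1, (s.sweepTo m k).Admissible a b := by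
  have hsum := (hs.sweepTo hk).2
  have hsum_eq : heightSum m (s.sweepTo m k) = heightSum m s :=
    Finset.sum_congr rfl fun a ha => hd a (Finset.mem_range.1 ha)
  rw [hsum_eq, Nat.sub_self, Nat.add_zero] at hsum
  refine ⟨hsum, ?_⟩
  clear hsum hsum_eq
  induction k with
  | zero => simp
  | succ k ih =>
    have hd' : ∀ a < m, (s.sweepTo m k).d a = s.d a := fun a ha =>
      le_antisymm ((le_sweepTo_d s a (Nat.le_succ k)).trans (hd a ha).le)
        (le_sweepTo_d s a (Nat.zero_le k))
    obtain ⟨ih1, ih2⟩ := ih (by omega) hd'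
    have hAB : ActiveBelow m (s.sweepTo m k) h := by
      have h1 := (hs.sweepTo (k := k) (by omega)).2
      have h2 : heightSum m (s.sweepTo m k) = heightSum m s :=
        Finset.sum_congr rfl fun a ha => hd' a (Finset.mem_range.1 ha)
      rwa [h2, Nat.sub_self, Nat.add_zero] at h1
    set u := s.sweepTo m k with hu
    have hstep : s.sweepTo m (k + 1) = u.discharge m k := rfl
    rw [hstep] at hd ⊢
    have hdk : (u.discharge m k).d k = u.d k := (hd k (by omega)).trans (hd' k (by omega)).symm
    -- Otherwise the relabel would raise `k`, but the sweep changes no height.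
    have hadm : u.d k < m + 1 → ∃ b < m + 1, (u.pushes m k (m + 1)).Admissible k b := by
      intro hlt
      by_contra hno
      simp only [Net.discharge, relabel, pushes_d] at hdk
      rw [if_pos ⟨rfl, by rwa [pushes_d], hno⟩] at hdk
      omega
    have hadm_iff : u.discharge m k = u.pushes m k (m + 1) := by
      ext x y
      · rfl
      · rfl
      · simp only [Net.discharge, relabel]
        rw [if_neg]
        rintro ⟨rfl, h2, h3⟩
        exact h3 (hadm (by rwa [pushes_d] at h2))
    rw [hadm_iff]
    constructor
    · intro a ha hact
      have hdlt : s.d a < m + 1 := by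
        have := hact.2; rw [pushes_d, hd' a (by omega)] at this; exact this
      by_cases hak : a = k
      · subst hak
        obtain ⟨b, hb, hb'⟩ := hadm (by rw [hd' a (by omega)]; exact hdlt)
        have h0 := pushes_e_eq_zero hb (by rw [hd' a (by omega)]; exact hdlt) hb'
        have := hact.1
        omega
      -- Excess arriving at an already discharged node comes from `k`, which is active and hence
      -- below level `h`; the receiver is one level lower still.
      · rcases pushes_e_pos hak hact.1 with h1 | ⟨h1, h2, h3⟩
        · exact ih1 a (by omega) ⟨h1, by rw [hd' a (by omega)]; exact hdlt⟩
        · have := hAB k (by omega) ⟨h3, h2⟩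
          rw [hd' a (by omega)] at h1
          omega
    · intro a ha hdlt
      by_cases hak : a = k
      · subst hak; exact hadm (by rw [hd' a (by omega)]; exact hdlt)
      · obtain ⟨b, hb, hr, hdd⟩ := ih2 a (by omega) hdlt
        exact ⟨b, hb, hr.trans_le (le_pushes_r hak _), by rw [pushes_d]; exact hdd⟩

theorem Valid.iterate_sweep {s : Net} (h : Valid m s) (i : ℕ) : Valid m ((Net.sweep m)^[i] s) := by
  induction i with
  | zero => exact h
  | succ i ih => rw [Function.iterate_succ_apply']; exact ih.sweep

theorem Within.iterate_sweep {E R : ℕ} {s : Net} (h : Within m E R s) (i : ℕ) :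
    Within m E R ((Net.sweep m)^[i] s) := by
  induction i with
  | zero => exact h
  | succ i ih => rw [Function.iterate_succ_apply']; exact ih.sweepTo le_rfl

theorem cut_iterate_sweep (s : Net) (i : ℕ) (A : Finset ℕ) :
    cut m ((Net.sweep m)^[i] s) A = cut m s A := by
  induction i with
  | zero => rfl
  | succ i ih => rw [Function.iterate_succ_apply', ← ih]; exact cut_sweepTo le_rfl A

/-- A sweep that raises the height sum by `δ ≥ 1` raises `h` by at most `δ`, so the left side grows
by at most `1 + δ ≤ 2δ`. A sweep without relabel lowers `h` by one and leaves the left side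
unchanged; if `h` is already zero, nothing is active and the state is stable. -/
theorem stable_or_potential (s : Net) (i : ℕ) :
    Stable m ((Net.sweep m)^[i] s) ∨
      ∃ h, ActiveBelow m ((Net.sweep m)^[i] s) h ∧
        i + h ≤ 2 * heightSum m ((Net.sweep m)^[i] s) + (m + 1) := by
  induction i with
  | zero => exact Or.inr ⟨m + 1, fun a _ ha => ha.2, by simp⟩
  | succ i ih =>
    rw [Function.iterate_succ_apply']
    set u := (Net.sweep m)^[i] s
    rcases ih with hst | ⟨h, hab, hle⟩
    · left; rwa [hst.sweep]
    · obtain ⟨h1, h2⟩ := hab.sweepTo (k := m) le_rfl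
      rcases h1.eq_or_lt with heq | hlt
      · have hd : ∀ a < m, (u.sweepTo m m).d a = u.d a := by
          have := (Finset.sum_eq_sum_iff_of_le
            (fun a _ => le_sweepTo_d u a (Nat.zero_le m))).1 heq
          exact fun a ha => (this a (Finset.mem_range.2 ha)).symm
        obtain ⟨h3, h4, h5⟩ := sweepTo_of_d_eq hab le_rfl hd
        rcases Nat.eq_zero_or_pos h with h0 | h0
        · left
          refine ⟨fun a ha hda => ?_, fun a ha hda => h5 a ha (by rw [← hd a ha]; exact hda)⟩
          by_contra hne
          have := h3 a ha ⟨Nat.pos_of_ne_zero hne, hda⟩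
          omega
        · right
          refine ⟨h - 1, fun a ha hact => ?_, ?_⟩
          · have h6 := h4 a ha hact
            have h7 := hd a ha
            simp only [Net.sweep]
            omega
          · simp only [Net.sweep]; omega
      · right
        exact ⟨_, h2, by simp only [Net.sweep]; omega⟩

/-- The height sum never exceeds `m(m+1)`, so an unstable state would force `i ≤ 2m(m+1) + m + 1 <
2(m+1)²`. -/
theorem stable_iterate_sweep {s : Net} (hv : Valid m s) {i : ℕ} (hi : 2 * (m + 1) * (m + 1) ≤ i) :
    Stable m ((Net.sweep m)^[i] s) := by
  rcases stable_or_potential s i with h | ⟨h, -, hle⟩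
  · exact h
  · exfalso
    have h1 : heightSum m ((Net.sweep m)^[i] s) ≤ m * (m + 1) := by
      refine (Finset.sum_le_card_nsmul _ _ (m + 1) fun a ha => ?_).trans (by simp)
      exact (hv.iterate_sweep i).le a (Finset.mem_range.1 ha).le
    nlinarith

/-! #### The minimum cut -/

/-- The nodes at the height cap. -/
def top (m : ℕ) (s : Net) : Finset ℕ := (Finset.range (m + 1)).filter fun a => s.d a = m + 1

/-- Gap argument: a residual arc from the cap would end at a node `b` of height exactly `m`.
Admissible arcs lead from `b` down one level at a time, so all of the levels `0, …, m + 1` would be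
occupied, which are `m + 2` levels for `m + 1` nodes. -/
theorem Stable.r_eq_zero {s : Net} (hs : Stable m s) (hv : Valid m s) {a b : ℕ}
    (ha : a ∈ top m s) (hb : b ≤ m) (hb' : b ∉ top m s) : s.r a b = 0 := by
  by_contra hr
  have hrpos := Nat.pos_of_ne_zero hr
  simp only [top, Finset.mem_filter, Finset.mem_range, not_and] at ha hb'
  have h1 := hv.arc a (by omega) b hb hrpos
  have h2 := hv.le b hb
  have h3 := hb' (by omega)
  have hall : ∀ i j, i + j = m → ∃ c ≤ m, s.d c = j := by
    intro i
    induction i with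
    | zero => intro j hj; exact ⟨b, hb, by omega⟩
    | succ i ih =>
      intro j hj
      obtain ⟨c, hc, hcd⟩ := ih (j + 1) (by omega)
      have hcm : c ≠ m := by
        rintro rfl
        have := hv.sink
        omega
      obtain ⟨c', hc', -, hd⟩ := hs.arc c (by omega) (by omega)
      exact ⟨c', by omega, by omega⟩
  have hsub : Finset.range (m + 2) ⊆ (Finset.range (m + 1)).image s.d := by
    intro j hj
    rw [Finset.mem_range] at hj
    rw [Finset.mem_image]
    by_cases hjm : j = m + 1
    · exact ⟨a, Finset.mem_range.2 ha.1, by omega⟩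
    · obtain ⟨c, hc, hcd⟩ := hall (m - j) j (by omega)
      exact ⟨c, Finset.mem_range.2 (by omega), hcd⟩
  have := (Finset.card_le_card hsub).trans Finset.card_image_le
  simp at this

theorem sink_notMem_top {s : Net} (hv : Valid m s) : m ∉ top m s := by
  simp [top, hv.sink]

theorem Stable.cut_top {s : Net} (hs : Stable m s) (hv : Valid m s) :
    cut m s (top m s) =
      -∑ x ∈ Finset.range (m + 1), (if x ∈ top m s then (s.e x : ℤ) else 0) := by
  unfold cut
  rw [Finset.sum_eq_zero, zero_sub]
  intro x _
  refine Finset.sum_eq_zero fun y hy => ?_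
  split_ifs with h
  · have := hs.r_eq_zero hv h.1 (by simpa [Nat.lt_succ_iff] using hy) h.2
    exact_mod_cast this
  · rfl

/-- All excess outside the sink sits at the height cap. -/
theorem Stable.sum_e_le {s : Net} (hs : Stable m s) (hv : Valid m s) {A : Finset ℕ} (hA : m ∉ A) :
    ∑ x ∈ Finset.range (m + 1), (if x ∈ A then (s.e x : ℤ) else 0) ≤
      ∑ x ∈ Finset.range (m + 1), (if x ∈ top m s then (s.e x : ℤ) else 0) := by
  refine Finset.sum_le_sum fun x hx => ?_
  rw [Finset.mem_range] at hx
  by_cases h1 : x ∈ top m s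
  · simp only [h1, if_true]; split_ifs <;> simp
  · simp only [h1, if_false]
    split_ifs with h2
    · have hxm : x ≠ m := fun h => hA (h ▸ h2)
      have h3 := hv.le x (by omega)
      have h4 : s.d x ≠ m + 1 := fun h => h1 (by simp [top, hx, h])
      have := hs.e x (by omega) (by omega)
      simp [this]
    · rfl

theorem Stable.cut_top_le {s : Net} (hs : Stable m s) (hv : Valid m s) {A : Finset ℕ}
    (hA : m ∉ A) : cut m s (top m s) ≤ cut m s A := by
  rw [hs.cut_top hv]
  have h1 := hs.sum_e_le hv hA
  have h2 : 0 ≤ ∑ x ∈ Finset.range (m + 1), ∑ y ∈ Finset.range (m + 1),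
      (if x ∈ A ∧ y ∉ A then (s.r x y : ℤ) else 0) :=
    Finset.sum_nonneg fun x _ => Finset.sum_nonneg fun y _ => by split_ifs <;> simp
  unfold cut
  linarith

/-- A minimum cut `A` has no residual arc leaving it. A node of `A` below the cap would have an
admissible arc, hence a lower neighbour in `A`; descending like this never ends, as the sink is not
in `A`. This is why nodes are relabelled even without excess. -/
theorem Stable.subset_top {s : Net} (hs : Stable m s) (hv : Valid m s) {A : Finset ℕ}
    (hA : m ∉ A) (hAm : ∀ a ∈ A, a ≤ m) (hcut : cut m s A ≤ cut m s (top m s)) :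
    A ⊆ top m s := by
  rw [hs.cut_top hv] at hcut
  have h1 := hs.sum_e_le hv hA
  have h0 : ∀ x ∈ Finset.range (m + 1), 0 ≤ ∑ y ∈ Finset.range (m + 1),
      (if x ∈ A ∧ y ∉ A then (s.r x y : ℤ) else 0) :=
    fun x _ => Finset.sum_nonneg fun y _ => by split_ifs <;> simp
  have h2 : ∑ x ∈ Finset.range (m + 1), ∑ y ∈ Finset.range (m + 1),
      (if x ∈ A ∧ y ∉ A then (s.r x y : ℤ) else 0) = 0 := by
    refine le_antisymm ?_ (Finset.sum_nonneg h0)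
    unfold cut at hcut
    linarith
  have hclosed : ∀ x ∈ A, ∀ y ≤ m, y ∉ A → s.r x y = 0 := by
    intro x hx y hy hyA
    have h3 := (Finset.sum_eq_zero_iff_of_nonneg h0).1 h2 x
      (Finset.mem_range.2 (by have := hAm x hx; omega))
    have h4 := (Finset.sum_eq_zero_iff_of_nonneg
      (fun y _ => by split_ifs <;> simp)).1 h3 y (Finset.mem_range.2 (by omega))
    rw [if_pos ⟨hx, hyA⟩] at h4
    exact_mod_cast h4
  have main : ∀ h, ∀ a ∈ A, s.d a = h → a ∈ top m s := by
    intro h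
    induction h using Nat.strong_induction_on with
    | _ h ih =>
      intro a ha hda
      by_contra hnot
      have ham := hAm a ha
      have hne : a ≠ m := fun h => hA (h ▸ ha)
      have h4 : s.d a ≠ m + 1 := fun h => hnot (by simp [top, h]; omega)
      have h5 := hv.le a ham
      obtain ⟨b, hb, hr, hd⟩ := hs.arc a (by omega) (by omega)
      have hbA : b ∈ A := by
        by_contra hbA
        have := hclosed a ha b (by omega) hbA
        omega
      have := ih (s.d b) (by omega) b hbA rfl
      simp only [top, Finset.mem_filter] at this
      omega
  exact fun a ha => main _ a ha rfl

end Net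

/-! ### Bottlenecks as maximal minimizers -/

section Lagrangian

variable {V : Type*} (G : SimpleGraph V) (w : V → ℕ)

theorem mem_nbhdIn {X S : Finset V} {v : V} :
    v ∈ nbhdIn G X S ↔ v ∈ X ∧ ∃ u ∈ S, G.Adj u v := by
  simp [nbhdIn]

theorem nbhdIn_subset (X S : Finset V) : nbhdIn G X S ⊆ X :=
  fun _ h => ((mem_nbhdIn G).1 h).1

theorem nbhdIn_empty (X : Finset V) : nbhdIn G X ∅ = ∅ := by
  ext v; simp [mem_nbhdIn]

theorem setWeight_mono {S T : Finset V} (h : S ⊆ T) : setWeight w S ≤ setWeight w T :=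
  Finset.sum_le_sum_of_subset h

theorem setWeight_pos (hw : ∀ v, 0 < w v) {S : Finset V} (h : S.Nonempty) : 0 < setWeight w S :=
  Finset.sum_pos (fun v _ => hw v) h

/-- `q · w(Γ(T)) - p · w(T)`. -/
noncomputable def lagrangian (X : Finset V) (p q : ℕ) (T : Finset V) : ℤ :=
  q * setWeight w (nbhdIn G X T) - p * setWeight w T

theorem lagrangian_empty (X : Finset V) (p q : ℕ) : lagrangian G w X p q ∅ = 0 := by
  simp [lagrangian, nbhdIn_empty, setWeight]

/-- `L` is the largest minimizer of the Lagrangian among the subsets of `X`. -/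
def IsMaxMinimizer (X : Finset V) (p q : ℕ) (L : Finset V) : Prop :=
  L ⊆ X ∧ (∀ T ⊆ X, lagrangian G w X p q L ≤ lagrangian G w X p q T) ∧
    ∀ T ⊆ X, lagrangian G w X p q T ≤ lagrangian G w X p q L → T ⊆ L

open Classical in
theorem setWeight_nbhdIn_submodular (X S T : Finset V) :
    setWeight w (nbhdIn G X (S ∪ T)) + setWeight w (nbhdIn G X (S ∩ T)) ≤
      setWeight w (nbhdIn G X S) + setWeight w (nbhdIn G X T) := by
  have h1 : nbhdIn G X (S ∪ T) = nbhdIn G X S ∪ nbhdIn G X T := by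
    ext v; simp only [mem_nbhdIn, Finset.mem_union]; grind
  have h2 : nbhdIn G X (S ∩ T) ⊆ nbhdIn G X S ∩ nbhdIn G X T := by
    intro v; simp only [mem_nbhdIn, Finset.mem_inter]; grind
  have h3 := setWeight_mono w h2
  have h4 : setWeight w (nbhdIn G X S ∪ nbhdIn G X T) + setWeight w (nbhdIn G X S ∩ nbhdIn G X T)
      = setWeight w (nbhdIn G X S) + setWeight w (nbhdIn G X T) := Finset.sum_union_inter
  rw [h1]; omega

variable {G w}

/-- Lowering the multiplier shrinks the largest minimizer. -/
theorem IsMaxMinimizer.subset_of_lt (hw : ∀ v, 0 < w v) {X L₁ L₂ : Finset V} {p₁ q₁ p₂ q₂ : ℕ}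
    (h₁ : IsMaxMinimizer G w X p₁ q₁ L₁) (h₂ : IsMaxMinimizer G w X p₂ q₂ L₂)
    (hlt : p₂ * q₁ < p₁ * q₂) : L₂ ⊆ L₁ := by
  classical
  -- Uncrossing: let `δ = w(L₂ \ L₁)`. Comparing `L₁` with the union bounds `w(Γ(L₂)) - w(Γ(L₁ ∩
  -- L₂))` below by `p₁δ/q₁`, and comparing `L₂` with the intersection bounds it above by `p₂δ/q₂`
  -- (with denominators cleared below). As `p₂/q₂ < p₁/q₁`, this forces `δ = 0`.
  have e₁ := h₁.2.1 (L₁ ∪ L₂) (Finset.union_subset h₁.1 h₂.1)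
  have e₂ := h₂.2.1 (L₁ ∩ L₂) (Finset.inter_subset_left.trans h₁.1)
  have e₃ := setWeight_nbhdIn_submodular G w X L₁ L₂
  have e₄ : setWeight w (L₁ ∪ L₂) + setWeight w (L₁ ∩ L₂) = setWeight w L₁ + setWeight w L₂ :=
    Finset.sum_union_inter
  have e₅ : setWeight w (L₁ ∩ L₂) ≤ setWeight w L₂ := setWeight_mono w Finset.inter_subset_right
  have e₆ : setWeight w (L₂ \ L₁) + setWeight w (L₁ ∩ L₂) = setWeight w L₂ := by
    rw [Finset.inter_comm]; unfold setWeight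
    rw [add_comm]; exact Finset.sum_inter_add_sum_sdiff _ _ _
  unfold lagrangian at e₁ e₂
  by_contra hsub
  have hpos : 0 < setWeight w (L₂ \ L₁) := setWeight_pos w hw (Finset.sdiff_nonempty.2 hsub)
  set A := setWeight w (nbhdIn G X (L₁ ∪ L₂))
  set B := setWeight w (nbhdIn G X (L₁ ∩ L₂))
  set C := setWeight w (nbhdIn G X L₁)
  set D := setWeight w (nbhdIn G X L₂)
  set δ := setWeight w (L₂ \ L₁)
  have i₁ : (p₁ : ℤ) * δ ≤ q₁ * (D - B) := by
    have h3 : (setWeight w (L₁ ∪ L₂) : ℤ) = setWeight w L₁ + δ := by omega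
    have h5 : (q₁ : ℤ) * (A - C) ≤ q₁ * (D - B) :=
      mul_le_mul_of_nonneg_left (by omega) (by positivity)
    rw [h3] at e₁
    linarith
  have i₂ : (q₂ : ℤ) * (D - B) ≤ p₂ * δ := by
    have h3 : (setWeight w L₂ : ℤ) = setWeight w (L₁ ∩ L₂) + δ := by omega
    rw [h3] at e₂
    linarith
  have i₃ : (q₂ : ℤ) * (p₁ * δ) ≤ q₁ * (p₂ * δ) :=
    calc (q₂ : ℤ) * (p₁ * δ) ≤ q₂ * (q₁ * (D - B)) :=
          mul_le_mul_of_nonneg_left i₁ (by positivity)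
      _ = q₁ * (q₂ * (D - B)) := by ring
      _ ≤ _ := mul_le_mul_of_nonneg_left i₂ (by positivity)
  have i₄ : p₂ * q₁ * δ < p₁ * q₂ * δ := Nat.mul_lt_mul_of_pos_right hlt hpos
  zify at i₄
  nlinarith

theorem alphaRatio_le_iff (hw : ∀ v, 0 < w v) {X S T : Finset V} (hS : S.Nonempty)
    (hT : T.Nonempty) : alphaRatio G w X S ≤ alphaRatio G w X T ↔
      setWeight w (nbhdIn G X S) * setWeight w T ≤ setWeight w (nbhdIn G X T) * setWeight w S := by
  have h1 := setWeight_pos w hw hS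
  have h2 := setWeight_pos w hw hT
  unfold alphaRatio
  rw [div_le_div_iff₀ (by exact_mod_cast h1) (by exact_mod_cast h2)]
  exact_mod_cast Iff.rfl

/-- The Lagrangian whose multiplier is the `α`-ratio of `S`. -/
noncomputable abbrev ratioLagrangian (G : SimpleGraph V) (w : V → ℕ) (X S : Finset V) :
    Finset V → ℤ :=
  lagrangian G w X (setWeight w (nbhdIn G X S)) (setWeight w S)

theorem ratioLagrangian_self (X S : Finset V) : ratioLagrangian G w X S S = 0 := by
  simp only [ratioLagrangian, lagrangian]; ring

theorem ratioLagrangian_nonneg_iff (hw : ∀ v, 0 < w v) {X S T : Finset V} (hS : S.Nonempty)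
    (hT : T.Nonempty) :
    0 ≤ ratioLagrangian G w X S T ↔ alphaRatio G w X S ≤ alphaRatio G w X T := by
  rw [alphaRatio_le_iff hw hS hT, ratioLagrangian, lagrangian, sub_nonneg,
    mul_comm (setWeight w (nbhdIn G X T))]
  exact_mod_cast Iff.rfl

theorem ratioLagrangian_nonpos_iff (hw : ∀ v, 0 < w v) {X S T : Finset V} (hS : S.Nonempty)
    (hT : T.Nonempty) :
    ratioLagrangian G w X S T ≤ 0 ↔ alphaRatio G w X T ≤ alphaRatio G w X S := by
  rw [alphaRatio_le_iff hw hT hS, ratioLagrangian, lagrangian, sub_nonpos,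
    mul_comm (setWeight w (nbhdIn G X T))]
  exact_mod_cast Iff.rfl

/-- `L` is the largest minimizer of the Lagrangian given by the `α`-ratio of `S`. -/
abbrev IsRatioStep (G : SimpleGraph V) (w : V → ℕ) (X S L : Finset V) : Prop :=
  IsMaxMinimizer G w X (setWeight w (nbhdIn G X S)) (setWeight w S) L

/-- The Lagrangian is zero both at `∅` and at `S`, so if `∅` is a minimizer then so is `S`, and the
largest minimizer contains it. -/
theorem IsRatioStep.nonempty {X S L : Finset V} (h : IsRatioStep G w X S L) (hSX : S ⊆ X)
    (hS : S.Nonempty) : L.Nonempty := by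
  by_contra hL
  rw [Finset.not_nonempty_iff_eq_empty] at hL
  subst hL
  have h1 := ratioLagrangian_self (G := G) (w := w) X S
  have h2 := h.2.2 S hSX (by
    rw [lagrangian_empty]; exact h1.le)
  exact hS.ne_empty (Finset.subset_empty.1 h2)

theorem IsRatioStep.alphaRatio_le (hw : ∀ v, 0 < w v) {X S L : Finset V}
    (h : IsRatioStep G w X S L) (hSX : S ⊆ X) (hS : S.Nonempty) :
    alphaRatio G w X L ≤ alphaRatio G w X S := by
  rw [← ratioLagrangian_nonpos_iff hw hS (h.nonempty hSX hS)]
  exact (h.2.1 S hSX).trans (ratioLagrangian_self X S).le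

/-- At the minimum ratio the Lagrangian is nonnegative, and its nonempty zeros are exactly the
bottlenecks. The largest minimizer therefore contains every bottleneck. -/
theorem IsRatioStep.isMaximalBottleneck (hw : ∀ v, 0 < w v) {X S L : Finset V}
    (hS : IsBottleneck G w X S) (h : IsRatioStep G w X S L) : IsMaximalBottleneck G w X L := by
  have hL := h.nonempty hS.1 hS.2.1
  have hle := h.alphaRatio_le hw hS.1 hS.2.1
  refine ⟨⟨h.1, hL, fun T hT hT' => hle.trans (hS.2.2 T hT hT')⟩, fun B' hss hB' => ?_⟩
  by_contra hlt
  rw [not_lt] at hlt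
  have hB'n : B'.Nonempty := hL.mono hss.1
  have h1 := (ratioLagrangian_nonpos_iff hw hS.2.1 hB'n).2 (hlt.trans hle)
  have h2 := (ratioLagrangian_nonneg_iff hw hS.2.1 hL).2 (hS.2.2 L h.1 hL)
  exact hss.2 (h.2.2 B' hB' (h1.trans h2))

theorem IsRatioStep.eq_of_isMaximalBottleneck (hw : ∀ v, 0 < w v) {X S L B : Finset V}
    (hS : IsBottleneck G w X S) (h : IsRatioStep G w X S L) (hB : IsMaximalBottleneck G w X B) :
    B = L := by
  have hL := h.isMaximalBottleneck hw hS
  have h1 := (ratioLagrangian_nonpos_iff hw hS.2.1 hB.1.2.1).2 (hB.1.2.2 S hS.1 hS.2.1)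
  have h2 := (ratioLagrangian_nonneg_iff hw hS.2.1 hL.1.2.1).2 (hS.2.2 L hL.1.1 hL.1.2.1)
  have h3 : B ⊆ L := h.2.2 B hB.1.1 (h1.trans h2)
  by_contra hne
  have h4 := hB.2 L (Finset.ssubset_iff_subset_ne.2 ⟨h3, hne⟩) h.1
  exact absurd (hL.1.2.2 B hB.1.1 hB.1.2.1) (not_le.2 h4)

theorem IsRatioStep.alphaRatio_lt (hw : ∀ v, 0 < w v) {X S L : Finset V}
    (hSX : S ⊆ X) (hS : S.Nonempty) (hnot : ¬ IsBottleneck G w X S) (h : IsRatioStep G w X S L) :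
    alphaRatio G w X L < alphaRatio G w X S := by
  simp only [IsBottleneck, hSX, hS, true_and, not_forall, not_le] at hnot
  obtain ⟨T, hT, hTn, hlt⟩ := hnot
  rw [← not_le, ← ratioLagrangian_nonneg_iff hw hS hTn, not_le] at hlt
  rw [← not_le, ← ratioLagrangian_nonneg_iff hw hS (h.nonempty hSX hS), not_le]
  exact (h.2.1 T hT).trans_lt hlt

/-- Repeated ratio steps from `X` reach the maximal bottleneck. -/
theorem isMaximalBottleneck_of_ratioSteps (hw : ∀ v, 0 < w v) {X : Finset V} (hX : X.Nonempty)
    {S : ℕ → Finset V} (h0 : S 0 = X) {n : ℕ} (hn : X.card ≤ n)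
    (hS : ∀ i ≤ n, IsRatioStep G w X (S i) (S (i + 1))) :
    IsMaximalBottleneck G w X (S (n + 1)) ∧
      ∀ B, IsMaximalBottleneck G w X B → B = S (n + 1) := by
  have hsub : ∀ i ≤ n + 1, S i ⊆ X ∧ (S i).Nonempty := by
    intro i
    induction i with
    | zero => intro _; rw [h0]; exact ⟨subset_rfl, hX⟩
    | succ i ih =>
      intro hi
      obtain ⟨h1, h2⟩ := ih (by omega)
      exact ⟨(hS i (by omega)).1, (hS i (by omega)).nonempty h1 h2⟩
  -- Before a bottleneck is met, the multipliers strictly decrease, so from `S 1` on the sets are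
  -- nested; they are nested properly because their ratios differ. At `i = n` the second alternative
  -- would make `S (n + 1)` empty. One further step turns the bottleneck `S n` into the maximal one.
  have main : ∀ i ≤ n, IsBottleneck G w X (S i) ∨ (S (i + 1)).card + i ≤ X.card := by
    intro i
    induction i with
    | zero => intro hi; exact Or.inr (Finset.card_le_card (hsub 1 (by omega)).1)
    | succ i ih =>
      intro hi
      by_cases hb' : IsBottleneck G w X (S (i + 1))
      · exact Or.inl hb'
      · obtain ⟨h1, h2⟩ := hsub i (by omega)
        obtain ⟨h3, h4⟩ := hsub (i + 1) (by omega)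
        obtain ⟨h5, h6⟩ := hsub (i + 2) (by omega)
        rcases ih (by omega) with hb | hc
        · exact absurd ((hS i (by omega)).isMaximalBottleneck hw hb).1 hb'
        · right
          have hb : ¬ IsBottleneck G w X (S i) := fun hb =>
            hb' ((hS i (by omega)).isMaximalBottleneck hw hb).1
          have hlt := (hS i (by omega)).alphaRatio_lt hw h1 h2 hb
          have hlt' := (hS (i + 1) hi).alphaRatio_lt hw h3 h4 hb'
          have hss : S (i + 2) ⊂ S (i + 1) := by
            refine Finset.ssubset_iff_subset_ne.2 ⟨?_, fun h => ?_⟩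
            · refine (hS i (by omega)).subset_of_lt hw (hS (i + 1) hi) ?_
              rw [← not_le, alphaRatio_le_iff hw h2 h4, not_le] at hlt
              exact hlt
            · rw [h] at hlt'; exact lt_irrefl _ hlt'
          have := Finset.card_lt_card hss
          rw [show i + 1 + 1 = i + 2 from rfl]
          omega
  have hb : IsBottleneck G w X (S n) := by
    rcases main n le_rfl with hb | hc
    · exact hb
    · have := (hsub (n + 1) le_rfl).2.card_pos
      omega
  exact ⟨(hS n le_rfl).isMaximalBottleneck hw hb, fun B hB =>
    (hS n le_rfl).eq_of_isMaximalBottleneck hw hb hB⟩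

/-! ### Peeling off the unique first pair of a decomposition -/

theorem isBottleneckDecomposition_empty_iff {L : List (Finset V × Finset V)} :
    IsBottleneckDecomposition G w ∅ L ↔ L = [] := by
  cases L with
  | nil => simp [IsBottleneckDecomposition]
  | cons P L =>
    obtain ⟨B, C⟩ := P
    simp only [IsBottleneckDecomposition, reduceCtorEq, iff_false]
    rintro ⟨h, -⟩
    exact h.1.2.1.ne_empty (Finset.subset_empty.1 h.1.1)

open Classical in
theorem isBottleneckDecomposition_iff {X B : Finset V} (hX : X.Nonempty)
    (hB : IsMaximalBottleneck G w X B) (huniq : ∀ B', IsMaximalBottleneck G w X B' → B' = B)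
    {L : List (Finset V × Finset V)} :
    IsBottleneckDecomposition G w X L ↔ ∃ L', L = (B, nbhdIn G X B) :: L' ∧
      IsBottleneckDecomposition G w (X \ (B ∪ nbhdIn G X B)) L' := by
  cases L with
  | nil => simp [IsBottleneckDecomposition, hX.ne_empty]
  | cons P L =>
    obtain ⟨B', C⟩ := P
    simp only [IsBottleneckDecomposition]
    constructor
    · rintro ⟨h1, rfl, h3⟩
      obtain rfl := huniq B' h1
      exact ⟨L, rfl, h3⟩
    · rintro ⟨L', h1, h2⟩
      simp only [List.cons.injEq, Prod.mk.injEq] at h1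
      obtain ⟨⟨rfl, rfl⟩, rfl⟩ := h1
      exact ⟨hB, rfl, h2⟩

end Lagrangian

/-! ### The bottleneck network -/

section Network

variable {n : ℕ} (G : SimpleGraph (Fin n)) (w : Fin n → ℕ)

open Classical in
/-- The network on the left copies `u`, the right copies `n + v` and the sink `2 * n` whose cuts
give the Lagrangian of `G[X]`. -/
structure IsBottleneckNet (X : Finset (Fin n)) (p q big : ℕ) (s : Net) : Prop where
  left : ∀ u v : Fin n, s.r u (n + v) = if u ∈ X ∧ v ∈ X ∧ G.Adj u v then big else 0
  right : ∀ v : Fin n, s.r (n + v) (2 * n) = if v ∈ X then w v * q else 0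
  left_left : ∀ u v : Fin n, s.r u v = 0
  left_sink : ∀ u : Fin n, s.r u (2 * n) = 0
  right_left : ∀ u v : Fin n, s.r (n + u) v = 0
  right_right : ∀ u v : Fin n, s.r (n + u) (n + v) = 0
  e_left : ∀ u : Fin n, s.e u = if u ∈ X then w u * p else 0
  e_right : ∀ v : Fin n, s.e (n + v) = 0
  d : ∀ a, a ≤ 2 * n → s.d a = 0

theorem sum_range_two_mul_add_one {M : Type*} [AddCommMonoid M] (f : ℕ → M) :
    ∑ a ∈ Finset.range (2 * n + 1), f a =
      ∑ u : Fin n, f u + ∑ v : Fin n, f (n + v) + f (2 * n) := by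
  rw [Finset.sum_range_succ, two_mul, Finset.sum_range_add, Finset.sum_range, Finset.sum_range]

variable {G w} {X : Finset (Fin n)} {p q big : ℕ} {s : Net}

open Classical in
theorem IsBottleneckNet.cut_eq (hs : IsBottleneckNet G w X p q big s) {A : Finset ℕ}
    (hA : 2 * n ∉ A) : Net.cut (2 * n) s A =
      ∑ u : Fin n, ∑ v : Fin n,
        (if (u : ℕ) ∈ A ∧ n + (v : ℕ) ∉ A ∧ u ∈ X ∧ v ∈ X ∧ G.Adj u v then (big : ℤ) else 0) +
      ∑ v : Fin n, (if n + (v : ℕ) ∈ A ∧ v ∈ X then (w v * q : ℤ) else 0) -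
      ∑ u : Fin n, (if (u : ℕ) ∈ A ∧ u ∈ X then (w u * p : ℤ) else 0) := by
  unfold Net.cut
  simp only [sum_range_two_mul_add_one, hs.left, hs.right, hs.left_left, hs.left_sink,
    hs.right_left, hs.right_right, hs.e_left, hs.e_right, hA, false_and, if_false, not_false_eq_true,
    and_true, Nat.cast_zero, ite_self, Finset.sum_const_zero, add_zero, zero_add]
  congr 1
  · congr 1
    · refine Finset.sum_congr rfl fun u _ => Finset.sum_congr rfl fun v _ => ?_
      split_ifs <;> simp_all
    · refine Finset.sum_congr rfl fun v _ => ?_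
      split_ifs <;> simp_all
  · refine Finset.sum_congr rfl fun v _ => ?_
    split_ifs <;> simp_all

-- The set `T` corresponds to the cut `C T` made of the left copies of `T` and the right copies of
-- `Γ(T)`, whose value is the Lagrangian of `T`. Conversely, a minimum cut has value at most that of
-- `C ∅`, which is zero. A crossing middle arc, of capacity above the total excess `p·w(X)`, would
-- make it positive. So a minimum cut contains the right copies of all neighbours of its left part
-- `L` and costs at least the Lagrangian of `L`.
open Classical in
theorem IsBottleneckNet.isMaxMinimizer (hs : IsBottleneckNet G w X p q big s)
    (hbig : p * setWeight w X < big) {S : Finset ℕ} (hS : 2 * n ∉ S)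
    (hmin : ∀ A : Finset ℕ, 2 * n ∉ A → Net.cut (2 * n) s S ≤ Net.cut (2 * n) s A)
    (hmax : ∀ A : Finset ℕ, 2 * n ∉ A → (∀ a ∈ A, a ≤ 2 * n) →
      Net.cut (2 * n) s A ≤ Net.cut (2 * n) s S → A ⊆ S) :
    IsMaxMinimizer G w X p q (X.filter fun u : Fin n => (u : ℕ) ∈ S) := by
  set L := X.filter fun u : Fin n => (u : ℕ) ∈ S with hL
  let C : Finset (Fin n) → Finset ℕ := fun T =>
    T.image (fun u : Fin n => (u : ℕ)) ∪ (nbhdIn G X T).image (fun v : Fin n => n + (v : ℕ))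
  have hCl : ∀ (T : Finset (Fin n)) (u : Fin n), (u : ℕ) ∈ C T ↔ u ∈ T := by
    intro T u
    simp only [C, Finset.mem_union, Finset.mem_image]
    constructor
    · rintro (⟨a, ha, h⟩ | ⟨a, ha, h⟩)
      · rwa [← Fin.ext h]
      · omega
    · exact fun h => Or.inl ⟨u, h, rfl⟩
  have hCr : ∀ (T : Finset (Fin n)) (v : Fin n), n + (v : ℕ) ∈ C T ↔ v ∈ nbhdIn G X T := by
    intro T v
    simp only [C, Finset.mem_union, Finset.mem_image]
    constructor
    · rintro (⟨a, ha, h⟩ | ⟨a, ha, h⟩)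
      · omega
      · rwa [← Fin.ext (show (a : ℕ) = v by omega)]
    · exact fun h => Or.inr ⟨v, h, rfl⟩
  have hCle : ∀ T, ∀ a ∈ C T, a < 2 * n := by
    intro T a
    simp only [C, Finset.mem_union, Finset.mem_image]
    rintro (⟨a, ha, h⟩ | ⟨a, ha, h⟩) <;> omega
  have hCs : ∀ T, 2 * n ∉ C T := fun T h => lt_irrefl _ (hCle T _ h)
  have hsum : ∀ (T : Finset (Fin n)) (c : ℕ), T ⊆ X →
      ∑ u : Fin n, (if u ∈ T ∧ u ∈ X then (w u * c : ℤ) else 0) = c * setWeight w T := by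
    intro T c hT
    rw [← Finset.sum_filter]
    have : Finset.univ.filter (fun u => u ∈ T ∧ u ∈ X) = T := by
      ext u; simpa using fun h => hT h
    rw [this, ← Finset.sum_mul, mul_comm]
    simp [setWeight]
  have hCcut : ∀ T ⊆ X, Net.cut (2 * n) s (C T) = lagrangian G w X p q T := by
    intro T hT
    rw [hs.cut_eq (hCs T)]
    simp only [hCl, hCr]
    rw [hsum _ q (nbhdIn_subset G X T), hsum T p hT, lagrangian,
      Finset.sum_eq_zero, zero_add]
    intro u _
    refine Finset.sum_eq_zero fun v _ => if_neg ?_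
    rintro ⟨h1, h2, h3, h4, h5⟩
    exact h2 ((mem_nbhdIn G).2 ⟨h4, u, h1, h5⟩)
  have hL' : ∀ u : Fin n, ((u : ℕ) ∈ S ∧ u ∈ X) ↔ u ∈ L ∧ u ∈ X := by
    intro u; simp [L]; tauto
  have hLX : L ⊆ X := Finset.filter_subset _ _
  have hScut := hs.cut_eq hS
  simp only [hL'] at hScut
  rw [hsum L p hLX] at hScut
  have hS0 : Net.cut (2 * n) s S ≤ 0 := by
    have h1 := hmin (C ∅) (hCs ∅)
    rwa [hCcut ∅ (Finset.empty_subset X), lagrangian_empty] at h1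
  have hn1 : ∀ u : Fin n, u ∈ Finset.univ → 0 ≤ ∑ v : Fin n, (if (u : ℕ) ∈ S ∧ n + (v : ℕ) ∉ S ∧
      u ∈ X ∧ v ∈ X ∧ G.Adj u v then (big : ℤ) else 0) :=
    fun u _ => Finset.sum_nonneg fun v _ => by split_ifs <;> simp
  have hn2 : 0 ≤ ∑ v : Fin n, (if n + (v : ℕ) ∈ S ∧ v ∈ X then (w v * q : ℤ) else 0) :=
    Finset.sum_nonneg fun v _ => by split_ifs <;> positivity
  have hΓ : ∀ v ∈ nbhdIn G X L, n + (v : ℕ) ∈ S := by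
    intro v hv
    obtain ⟨hvX, u, huL, huv⟩ := (mem_nbhdIn G).1 hv
    by_contra hvS
    have huL' := Finset.mem_filter.1 huL
    have h1 := Finset.single_le_sum hn1 (Finset.mem_univ u)
    have h2 := Finset.single_le_sum (f := fun v : Fin n => (if (u : ℕ) ∈ S ∧ n + (v : ℕ) ∉ S ∧
      u ∈ X ∧ v ∈ X ∧ G.Adj u v then (big : ℤ) else 0))
      (fun v _ => by split_ifs <;> simp) (Finset.mem_univ v)
    rw [if_pos ⟨huL'.2, hvS, huL'.1, hvX, huv⟩] at h2
    have h3 : p * setWeight w L ≤ p * setWeight w X :=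
      Nat.mul_le_mul_left p (setWeight_mono w hLX)
    zify at h3 hbig
    linarith
  have hLcut : lagrangian G w X p q L ≤ Net.cut (2 * n) s S := by
    have h1 : ((q : ℤ) * setWeight w (nbhdIn G X L)) ≤
        ∑ v : Fin n, (if n + (v : ℕ) ∈ S ∧ v ∈ X then (w v * q : ℤ) else 0) := by
      rw [← hsum _ q (nbhdIn_subset G X L)]
      refine Finset.sum_le_sum fun v _ => ?_
      split_ifs with h2 h3
      · exact le_rfl
      · exact absurd ⟨hΓ v h2.1, h2.2⟩ h3
      · positivity
      · exact le_rfl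
    have h2 := Finset.sum_nonneg hn1
    rw [hScut, lagrangian]
    linarith
  refine ⟨hLX, fun T hT => ?_, fun T hT hle => ?_⟩
  · rw [← hCcut T hT]; exact hLcut.trans (hmin _ (hCs T))
  · rw [← hCcut T hT] at hle
    have hsub := hmax (C T) (hCs T) (fun a ha => (hCle T a ha).le) (hle.trans hLcut)
    exact fun u hu => Finset.mem_filter.2 ⟨hT hu, hsub ((hCl T u).2 hu)⟩

theorem IsBottleneckNet.valid (hs : IsBottleneckNet G w X p q big s) : Net.Valid (2 * n) s :=
  ⟨fun a ha b hb _ => by rw [hs.d a ha]; omega, hs.d _ le_rfl, fun a ha => by rw [hs.d a ha]; omega⟩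

open Classical in
/-- Enough sweeps on the bottleneck network yield the largest minimizer of the Lagrangian. -/
theorem IsBottleneckNet.isMaxMinimizer_sweep (hs : IsBottleneckNet G w X p q big s)
    (hbig : p * setWeight w X < big) {t : ℕ} (ht : 2 * (2 * n + 1) * (2 * n + 1) ≤ t) :
    IsMaxMinimizer G w X p q
      (X.filter fun u : Fin n => ((Net.sweep (2 * n))^[t] s).d u = 2 * n + 1) := by
  have hst := Net.stable_iterate_sweep hs.valid ht
  have hv := hs.valid.iterate_sweep t
  have h := hs.isMaxMinimizer hbig (S := Net.top (2 * n) ((Net.sweep (2 * n))^[t] s))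
    (Net.sink_notMem_top hv)
    (fun A hA => by
      rw [← Net.cut_iterate_sweep s t, ← Net.cut_iterate_sweep s t]; exact hst.cut_top_le hv hA)
    (fun A hA hAm hle => by
      rw [← Net.cut_iterate_sweep s t, ← Net.cut_iterate_sweep s t] at hle
      exact hst.subset_top hv hA hAm hle)
  convert h using 2 with u
  simp only [Net.top, Finset.mem_filter, Finset.mem_range]
  exact ⟨fun h => ⟨by omega, h⟩, fun h => h.2⟩

end Network

/-! ### The program -/

namespace RAM

open RAM.Expr (lit var read)

/-! Scalars: `0` holds `n`, `1` the number of pairs found, `2` the number `N = 2 * n + 1` of network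
nodes, `3` holds `2 * n`, `4` the number of sweeps, `5` holds `n + 1`, `19` holds `N * N`; `13` and
`14` hold the weights of `Γ(S)` and `S`, `15` the weight of the remaining graph, `16` the capacity
of the middle arcs, `17` a flag, `18` a pushed amount, and `6` to `12` are loop counters.

Arrays: `4` is the indicator of the remaining graph, `5` that of `S`, `6` that of `Γ(S)`, and `7`,
`8`, `9` hold the residual capacities, excesses and heights. -/

/-- Compute the indicator of `Γ(S)`. -/
def nbhdCmd : Cmd :=
  forLoop 12 0 (.seq (.store 6 (var 12) (lit 0))
    (forLoop 11 0 (.store 6 (var 12)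
      -- The test `0 < old + bit` is a disjunction of bits.
      ((lit 0).lt (read 6 (var 12) +
        read 5 (var 11) * read 1 (var 11 * var 0 + var 12) * read 4 (var 12))))))

/-- Compute the weight of the set with indicator array `a` in the scalar `y`. -/
def weighCmd (y a : ℕ) : Cmd :=
  .seq (.assign y (lit 0))
    (forLoop 12 0 (.assign y (var y + read a (var 12) * read 0 (var 12))))

/-- Compute `Γ(S)`, its weight, and the weight of `S`. -/
def statsCmd : Cmd := .seq nbhdCmd (.seq (weighCmd 13 6) (weighCmd 14 5))

/-- The tail of the arc stored in cell `var 9` of the residual matrix. -/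
def tailExpr : Expr := var 9 / var 2

/-- The head of the arc stored in cell `var 9` of the residual matrix. -/
def headExpr : Expr := var 9 - var 9 / var 2 * var 2

/-- The initial residual capacity of the arc stored in cell `var 9`. -/
def capacityExpr : Expr :=
  -- Products of comparison bits are conjunctions, and `a < b + 1` stands for `a ≤ b`. Where
  -- truncated subtraction makes an index meaningless, one of the bits is zero.
  tailExpr.lt (var 0) * (var 0).lt (headExpr + lit 1) * headExpr.lt (var 3) * read 4 tailExpr *
      read 4 (headExpr - var 0) * read 1 (tailExpr * var 0 + (headExpr - var 0)) * var 16 +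
    (var 0).lt (tailExpr + lit 1) * tailExpr.lt (var 3) * headExpr.eq (var 3) *
      read 4 (tailExpr - var 0) * read 0 (tailExpr - var 0) * var 14

/-- Set up the bottleneck network. -/
def buildCmd : Cmd :=
  .seq (weighCmd 15 4) (.seq (.assign 16 (var 13 * var 15 + lit 1))
    (.seq (forLoop 9 2 (.store 8 (var 9)
        ((var 9).lt (var 0) * read 4 (var 9) * read 0 (var 9) * var 13)))
      (.seq (forLoop 9 2 (.store 9 (var 9) (lit 0)))
        (forLoop 9 19 (.store 7 (var 9) capacityExpr)))))

/-- Push from node `var 9` to node `var 10`, and raise the flag if the arc remains admissible. -/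
def pushCmd : Cmd :=
  .seq (.assign 18 ((read 9 (var 9)).eq (read 9 (var 10) + lit 1) * (read 9 (var 9)).lt (var 2) *
    -- With truncated subtraction, `r - (r - e)` is `min e r`.
    (read 7 (var 9 * var 2 + var 10) - (read 7 (var 9 * var 2 + var 10) - read 8 (var 9)))))
  (.seq (.store 7 (var 9 * var 2 + var 10) (read 7 (var 9 * var 2 + var 10) - var 18))
  (.seq (.store 7 (var 10 * var 2 + var 9) (read 7 (var 10 * var 2 + var 9) + var 18))
  (.seq (.store 8 (var 9) (read 8 (var 9) - var 18))
  (.seq (.store 8 (var 10) (read 8 (var 10) + var 18))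
    (.assign 17 ((lit 0).lt (var 17 + (read 9 (var 9)).eq (read 9 (var 10) + lit 1) *
      read 7 (var 9 * var 2 + var 10))))))))

/-- Discharge node `var 9`. -/
def dischargeCmd : Cmd :=
  .seq (.assign 17 (lit 0)) (.seq (forLoop 10 2 pushCmd)
    (.store 9 (var 9) (read 9 (var 9) + (var 17).eq (lit 0) * (read 9 (var 9)).lt (var 2))))

/-- One sweep. -/
def sweepCmd : Cmd := forLoop 9 3 dischargeCmd

/-- Replace `S` by the set of the remaining vertices at the height cap. -/
def extractCmd : Cmd :=
  forLoop 12 0 (.store 5 (var 12) (read 4 (var 12) * (read 9 (var 12)).eq (var 2)))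

/-- Replace `S` by the largest minimizer of the Lagrangian given by its `α`-ratio. -/
def ratioStepCmd : Cmd :=
  .seq statsCmd (.seq buildCmd (.seq (forLoop 8 4 sweepCmd) extractCmd))

/-- Find the maximal bottleneck of the remaining graph, record it with its neighbourhood, and
remove both. -/
def roundCmd : Cmd :=
  .seq (forLoop 12 0 (.store 5 (var 12) (read 4 (var 12))))
  (.seq (forLoop 7 5 ratioStepCmd)
  (.seq statsCmd
  (.seq (forLoop 12 0 (.store 2 (var 1 * var 0 + var 12) (read 5 (var 12))))
  (.seq (forLoop 12 0 (.store 3 (var 1 * var 0 + var 12) (read 6 (var 12))))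
  (.seq (forLoop 12 0 (.store 4 (var 12)
      (read 4 (var 12) * (read 5 (var 12) + read 6 (var 12)).eq (lit 0))))
    -- The counter moves only if the set found has positive weight, so rounds run after the last
    -- vertex is gone do not change the displayed list.
    (.assign 1 (var 1 + (lit 0).lt (var 14))))))))

/-- The bottleneck decomposition. -/
def decompositionCmd : Cmd :=
  .seq (.assign 2 (lit 2 * var 0 + lit 1))
  (.seq (.assign 3 (lit 2 * var 0))
  (.seq (.assign 19 (var 2 * var 2))
  (.seq (.assign 4 (lit 2 * var 19))
  (.seq (.assign 5 (var 0 + lit 1))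
  (.seq (forLoop 12 0 (.store 4 (var 12) (lit 1)))
    (forLoop 6 0 roundCmd))))))

/-! ### Correctness of its parts -/

open Classical in
/-- The constants of the computation are in memory. -/
structure Ctx {n : ℕ} (G : SimpleGraph (Fin n)) (w : Fin n → ℕ) (σ : State) : Prop where
  order : σ.reg 0 = n
  nodes : σ.reg 2 = 2 * n + 1
  sink : σ.reg 3 = 2 * n
  sweeps : σ.reg 4 = 2 * ((2 * n + 1) * (2 * n + 1))
  steps : σ.reg 5 = n + 1
  cells : σ.reg 19 = (2 * n + 1) * (2 * n + 1)
  weight : ∀ v : Fin n, σ.arr 0 v = w v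
  adj : ∀ u v : Fin n, σ.arr 1 (u * n + v) = if G.Adj u v then 1 else 0

/-- The array `f` is the indicator of `A`. -/
def Mask {n : ℕ} (f : ℕ → ℕ) (A : Finset (Fin n)) : Prop :=
  ∀ v : Fin n, f v = if v ∈ A then 1 else 0

/-- The bound `M` is large enough for the numbers of the computation. -/
structure Ample {n : ℕ} (w : Fin n → ℕ) (W M : ℕ) : Prop where
  roomy : Roomy W M
  nodes : 2 * ((2 * n + 1) * (2 * n + 1)) ≤ M
  weight : 2 * (setWeight w Finset.univ * setWeight w Finset.univ + 1) ≤ M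

variable {n : ℕ} {G : SimpleGraph (Fin n)} {w : Fin n → ℕ} {W M : ℕ} {σ : State}
  {X S : Finset (Fin n)}

theorem Ctx.of_agreesOff {c : Cmd} {σ' : State} (h : Ctx G w σ) (ha : AgreesOff c σ σ')
    (hr : ∀ x ∈ [0, 2, 3, 4, 5, 19], x ∉ c.regs) (hA : ∀ a ∈ [0, 1], a ∉ c.arrs) :
    Ctx G w σ' := by
  have e := fun x hx => ha.1 x (hr x hx)
  have f := fun x hx => ha.2 x (hA x hx)
  refine ⟨?_, ?_, ?_, ?_, ?_, ?_, ?_, ?_⟩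
  · rw [e 0 (by decide)]; exact h.order
  · rw [e 2 (by decide)]; exact h.nodes
  · rw [e 3 (by decide)]; exact h.sink
  · rw [e 4 (by decide)]; exact h.sweeps
  · rw [e 5 (by decide)]; exact h.steps
  · rw [e 19 (by decide)]; exact h.cells
  · rw [f 0 (by decide)]; exact h.weight
  · rw [f 1 (by decide)]; exact h.adj

theorem Ample.setWeight_le (h : Ample w W M) (A : Finset (Fin n)) : setWeight w A ≤ M := by
  have h1 := h.weight
  have h2 := setWeight_mono w (Finset.subset_univ A)
  nlinarith

theorem Ample.pos (h : Ample w W M) : 2 ≤ M := h.roomy.1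

theorem Mask.sum_eq {f g : ℕ → ℕ} {A : Finset (Fin n)} (hf : Mask f A)
    (hg : ∀ v : Fin n, g v = w v) : ∑ k ∈ Finset.range n, f k * g k = setWeight w A := by
  rw [Finset.sum_range]
  simp only [hf _, hg _, ite_mul, one_mul, zero_mul]
  rw [← Finset.sum_filter]
  simp [setWeight]

theorem run_nbhdCmd (hM : Ample w W M) (hσ : Bdd M σ) (hc : Ctx G w σ)
    (hX : Mask (σ.arr 4) X) (hS : Mask (σ.arr 5) S) :
    Run W M nbhdCmd σ (n * (n * 50 + 30) + 6) (fun τ => Mask (τ.arr 6) (nbhdIn G X S)) := by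
  classical
  have h2 := hM.pos
  refine (run_forLoop (T := n * 50 + 20) hM.roomy hσ
    (fun k τ => ∀ v : Fin n, (v : ℕ) < k → τ.arr 6 v = if v ∈ nbhdIn G X S then 1 else 0)
    hc.order (by decide) (by decide) (Nat.add_le_add_right (Nat.mul_le_mul_left n (by omega)) 6) (fun _ _ _ h => h) (by simp) ?_).mono le_rfl
    (fun τ _ _ h v => h v v.2)
  intro k hk τ hb hag hi hI
  refine run_seq (T₁ := 3) (T₂ := n * (40 + 8) + 6) (Q₁ := fun ρ => ρ = τ.setArr 6 k 0)
    (by omega) (run_store hM.roomy hb rfl rfl (by decide) (by simp) (by simp [hi])) ?_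
  rintro _ hb1 - rfl
  refine (run_forLoop (T := 40) (m := n) hM.roomy hb1
    (fun l ρ => ρ.arr 6 k = (if k < n ∧ ∃ u : Fin n, (u : ℕ) < l ∧ u ∈ S ∧ G.Adj u ⟨k, hk⟩ ∧
      (⟨k, hk⟩ : Fin n) ∈ X then 1 else 0) ∧ ∀ j, j ≠ k → ρ.arr 6 j = τ.arr 6 j)
    ?_ (by decide) (by decide) le_rfl (fun _ _ _ h => h) ?_ ?_).mono le_rfl ?_
  · rw [State.reg_setArr, hag.1 0 (by decide)]; exact hc.order
  · refine ⟨by simp [State.arr_setArr], fun j hj => by simp [State.arr_setArr, hj]⟩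
  · intro l hl ρ hbρ hagρ hiρ hIρ
    have h12 : ρ.reg 12 = k := by rw [hagρ.1 12 (by decide)]; exact hi
    have h0 : ρ.reg 0 = n := by
      rw [hagρ.1 0 (by decide), State.reg_setArr, hag.1 0 (by decide)]; exact hc.order
    have h5 : ρ.arr 5 l = if (⟨l, hl⟩ : Fin n) ∈ S then 1 else 0 := by
      rw [hagρ.2 5 (by decide)]
      have : τ.arr 5 = σ.arr 5 := hag.2 5 (by decide)
      rw [← hS ⟨l, hl⟩, ← this]; simp [State.arr_setArr]
    have h4 : ρ.arr 4 k = if (⟨k, hk⟩ : Fin n) ∈ X then 1 else 0 := by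
      rw [hagρ.2 4 (by decide)]
      have : τ.arr 4 = σ.arr 4 := hag.2 4 (by decide)
      rw [← hX ⟨k, hk⟩, ← this]; simp [State.arr_setArr]
    have h1 : ρ.arr 1 (l * n + k) = if G.Adj ⟨l, hl⟩ ⟨k, hk⟩ then 1 else 0 := by
      rw [hagρ.2 1 (by decide)]
      have : τ.arr 1 = σ.arr 1 := hag.2 1 (by decide)
      rw [← hc.adj ⟨l, hl⟩ ⟨k, hk⟩, ← this]; simp [State.arr_setArr]
    have hval : ((lit 0).lt (read 6 (var 12) +
        read 5 (var 11) * read 1 (var 11 * var 0 + var 12) * read 4 (var 12))).eval ρ =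
        if k < n ∧ ∃ u : Fin n, (u : ℕ) < l + 1 ∧ u ∈ S ∧ G.Adj u ⟨k, hk⟩ ∧
          (⟨k, hk⟩ : Fin n) ∈ X then 1 else 0 := by
      have hex : (∃ u : Fin n, (u : ℕ) < l + 1 ∧ u ∈ S ∧ G.Adj u ⟨k, hk⟩ ∧
          (⟨k, hk⟩ : Fin n) ∈ X) ↔ (∃ u : Fin n, (u : ℕ) < l ∧ u ∈ S ∧ G.Adj u ⟨k, hk⟩ ∧
          (⟨k, hk⟩ : Fin n) ∈ X) ∨ ((⟨l, hl⟩ : Fin n) ∈ S ∧ G.Adj ⟨l, hl⟩ ⟨k, hk⟩ ∧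
          (⟨k, hk⟩ : Fin n) ∈ X) := by
        constructor
        · rintro ⟨u, hu, h⟩
          rcases Nat.lt_succ_iff_lt_or_eq.1 hu with h' | h'
          · exact Or.inl ⟨u, h', h⟩
          · right
            have : u = ⟨l, hl⟩ := Fin.ext h'
            rwa [this] at h
        · rintro (⟨u, hu, h⟩ | h)
          · exact ⟨u, by omega, h⟩
          · exact ⟨⟨l, hl⟩, Nat.lt_succ_self l, h⟩
      simp only [Expr.eval_lt, Expr.eval_lit, Expr.eval_add, Expr.eval_mul, Expr.eval_read,
        Expr.eval_var, h12, hiρ, h0, h5, h4, h1, hIρ.1, hex]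
      split_ifs <;> first | rfl | (exfalso; grind)
    refine run_store hM.roomy hbρ rfl rfl (by decide) ?_ ?_
    · rw [hval]; split_ifs <;> omega
    · rw [hval, Expr.eval_var, h12]
      exact ⟨by simp [State.arr_setArr], fun j hj => by
        rw [State.arr_setArr, if_neg (by simp [hj])]; exact hIρ.2 j hj⟩
  · rintro ρ - - ⟨hρ, hρ'⟩ v hv
    by_cases hvk : (v : ℕ) = k
    · have hvk' : v = ⟨k, hk⟩ := Fin.ext hvk
      subst hvk'
      rw [hρ]
      refine if_congr ?_ rfl rfl
      rw [mem_nbhdIn]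
      constructor
      · rintro ⟨-, u, -, h1, h2, h3⟩; exact ⟨h3, u, h1, h2⟩
      · rintro ⟨h3, u, h1, h2⟩; exact ⟨hk, u, u.2, h1, h2, h3⟩
    · rw [hρ' _ hvk]
      exact hI v (by omega)

theorem run_weighCmd (hM : Ample w W M) (hσ : Bdd M σ) (hc : Ctx G w σ) {A : Finset (Fin n)}
    {y a : ℕ} (hA : Mask (σ.arr a) A) (hy : 12 < y) :
    Run W M (weighCmd y a) σ (n * 300 + 10) (fun τ => τ.reg y = setWeight w A) := by
  rw [← hA.sum_eq hc.weight]
  refine run_sum hM.roomy hσ (fun k => σ.arr a k * σ.arr 0 k) hc.order (by decide) (by omega)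
    (by omega) rfl le_rfl ?_ ?_
  · rw [hA.sum_eq hc.weight]; exact hM.setWeight_le A
  · intro k hk τ hr hi harr
    simp [hi, harr]

theorem run_statsCmd (hM : Ample w W M) (hσ : Bdd M σ) (hc : Ctx G w σ)
    (hX : Mask (σ.arr 4) X) (hS : Mask (σ.arr 5) S) :
    Run W M statsCmd σ (700 * (2 * n + 1) ^ 2) (fun τ => Mask (τ.arr 6) (nbhdIn G X S) ∧
      τ.reg 13 = setWeight w (nbhdIn G X S) ∧ τ.reg 14 = setWeight w S) := by
  refine run_seq (T₁ := n * (n * 50 + 30) + 6) (T₂ := (n * 300 + 10) + (n * 300 + 10))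
    (by nlinarith) (run_nbhdCmd hM hσ hc hX hS) ?_
  intro σ₁ hb₁ ha₁ h₁
  have hc₁ := hc.of_agreesOff ha₁ (by decide) (by decide)
  refine run_seq le_rfl (run_weighCmd hM hb₁ hc₁ h₁ (by decide)) ?_
  intro σ₂ hb₂ ha₂ h₂
  have hc₂ := hc₁.of_agreesOff ha₂ (by decide) (by decide)
  have hS₂ : Mask (σ₂.arr 5) S := by
    rw [ha₂.2 5 (by decide), ha₁.2 5 (by decide)]; exact hS
  refine (run_weighCmd hM hb₂ hc₂ hS₂ (by decide)).mono le_rfl ?_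
  intro σ₃ hb₃ ha₃ h₃
  refine ⟨?_, ?_, h₃⟩
  · rw [ha₃.2 6 (by decide), ha₂.2 6 (by decide)]; exact h₁
  · rw [ha₃.1 13 (by decide)]; exact h₂

/-! ### Building the network in memory -/

/-- The network in memory. -/
def netOf (n : ℕ) (σ : State) : Net where
  r x y := σ.arr 7 (x * (2 * n + 1) + y)
  e := σ.arr 8
  d := σ.arr 9

/-- The initial residual capacity of the arc from `a` to `b`. -/
def capacity (n : ℕ) (σ : State) (q big a b : ℕ) : ℕ :=
  (if a < n then 1 else 0) * (if n < b + 1 then 1 else 0) * (if b < 2 * n then 1 else 0) *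
      σ.arr 4 a * σ.arr 4 (b - n) * σ.arr 1 (a * n + (b - n)) * big +
    (if n < a + 1 then 1 else 0) * (if a < 2 * n then 1 else 0) * (if b = 2 * n then 1 else 0) *
      σ.arr 4 (a - n) * σ.arr 0 (a - n) * q

open Classical in
theorem capacity_left (hc : Ctx G w σ) (hX : Mask (σ.arr 4) X) (q big : ℕ) (u v : Fin n) :
    capacity n σ q big u (n + v) = if u ∈ X ∧ v ∈ X ∧ G.Adj u v then big else 0 := by
  have h1 : n + (v : ℕ) < 2 * n := by omega
  have h2 : n < n + (v : ℕ) + 1 := by omega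
  have h3 : ¬ n < (u : ℕ) + 1 := by omega
  simp only [capacity, u.2, h1, h2, h3, if_true, if_false, Nat.add_sub_cancel_left, hX u, hX v,
    hc.adj]
  split_ifs <;> simp_all

theorem capacity_right (hc : Ctx G w σ) (hX : Mask (σ.arr 4) X) (q big : ℕ) (v : Fin n) :
    capacity n σ q big (n + v) (2 * n) = if v ∈ X then w v * q else 0 := by
  have h1 : n + (v : ℕ) < 2 * n := by omega
  have h2 : n < n + (v : ℕ) + 1 := by omega
  simp only [capacity, h1, h2, lt_irrefl, if_true, if_false, Nat.add_sub_cancel_left, hX v,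
    hc.weight]
  split_ifs <;> simp

theorem capacity_eq_zero {q big a b : ℕ} (h₁ : ¬ (a < n ∧ n ≤ b ∧ b < 2 * n))
    (h₂ : ¬ (n ≤ a ∧ a < 2 * n ∧ b = 2 * n)) : capacity n σ q big a b = 0 := by
  unfold capacity
  split_ifs <;> first | (exfalso; omega) | simp

theorem capacity_le (hc : Ctx G w σ) (hX : Mask (σ.arr 4) X) {q big a b B : ℕ}
    (hb : b < 2 * n + 1) (hbig : big ≤ B) (hq : ∀ v, w v * q ≤ B) :
    capacity n σ q big a b ≤ B := by
  classical
  by_cases h₁ : a < n ∧ n ≤ b ∧ b < 2 * n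
  · obtain ⟨h, h', h''⟩ := h₁
    have := capacity_left hc hX q big ⟨a, h⟩ ⟨b - n, by omega⟩
    rw [show n + ((⟨b - n, by omega⟩ : Fin n) : ℕ) = b by simp; omega] at this
    simp only at this
    rw [this]; split_ifs <;> omega
  · by_cases h₂ : n ≤ a ∧ a < 2 * n ∧ b = 2 * n
    · obtain ⟨h, h', rfl⟩ := h₂
      have := capacity_right hc hX q big ⟨a - n, by omega⟩
      rw [show n + ((⟨a - n, by omega⟩ : Fin n) : ℕ) = a by simp; omega] at this
      rw [this]; split_ifs
      · exact hq _
      · omega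
    · rw [capacity_eq_zero h₁ h₂]; omega

theorem eval_capacityExpr (hc : Ctx G w σ) {τ : State} {k q big : ℕ}
    (hr : ∀ y, y ≠ 9 → τ.reg y = σ.reg y) (hk : τ.reg 9 = k)
    (ha : ∀ b, b ≠ 7 → τ.arr b = σ.arr b) (hq : σ.reg 14 = q) (hbig : σ.reg 16 = big) :
    capacityExpr.eval τ =
      capacity n σ q big (k / (2 * n + 1)) (k - k / (2 * n + 1) * (2 * n + 1)) := by
  simp only [capacityExpr, tailExpr, headExpr, Expr.eval_add, Expr.eval_mul, Expr.eval_lt,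
    Expr.eval_eq, Expr.eval_read, Expr.eval_var, Expr.eval_lit, Expr.eval_div, Expr.eval_sub, hk,
    hr 2 (by decide), hr 0 (by decide), hr 3 (by decide), hr 14 (by decide), hr 16 (by decide),
    hc.order, hc.nodes, hc.sink, hq, hbig, ha 4 (by decide), ha 1 (by decide), ha 0 (by decide),
    capacity]

/-- The middle capacity is one more than the total excess `p·w(X)`. With `t` the total weight, all
capacities are at most `t² + 1`, and two opposite ones add up to at most `2(t² + 1) ≤ M`, which
explains the form of `Ample.weight`. -/
theorem run_buildCmd (hM : Ample w W M) (hσ : Bdd M σ) (hc : Ctx G w σ)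
    (hX : Mask (σ.arr 4) X) {p q : ℕ} (hp : σ.reg 13 = p) (hq : σ.reg 14 = q)
    (hp' : p ≤ setWeight w Finset.univ) (hq' : q ≤ setWeight w Finset.univ) :
    Run W M buildCmd σ (2000 * (2 * n + 1) ^ 2) (fun τ =>
      IsBottleneckNet G w X p q (p * setWeight w X + 1) (netOf n τ) ∧
        Net.Within (2 * n) M M (netOf n τ)) := by
  classical
  set t := setWeight w Finset.univ with ht
  have hXt : setWeight w X ≤ t := setWeight_mono w (Finset.subset_univ X)
  have hMt := hM.weight
  rw [← ht] at hMt
  have hwt : ∀ v, w v ≤ t := fun v => Finset.single_le_sum (fun _ _ => Nat.zero_le _)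
    (Finset.mem_univ v)
  have hbig : p * setWeight w X + 1 ≤ t * t + 1 := Nat.add_le_add_right (Nat.mul_le_mul hp' hXt) 1
  refine run_seq (T₁ := n * 300 + 10)
    (T₂ := 6 + (((2 * n + 1) * 300 + 6) + (((2 * n + 1) * 300 + 6) +
      ((2 * n + 1) * (2 * n + 1) * 300 + 6)))) (by nlinarith)
    (run_weighCmd hM hσ hc hX (by decide)) ?_
  intro σ₁ hb₁ ha₁ h₁
  have hc₁ := hc.of_agreesOff ha₁ (by decide) (by decide)
  have hev : (var 13 * var 15 + lit 1).eval σ₁ = p * setWeight w X + 1 := by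
    simp [h₁, ha₁.1 13 (by decide), hp]
  refine run_seq le_rfl (Q₁ := fun τ => τ = σ₁.setReg 16 (p * setWeight w X + 1))
    (run_assign hM.roomy hb₁ rfl (by decide) (by rw [hev]; omega) (by rw [hev])) ?_
  rintro σ₂ hb₂ ha₂ rfl
  set σ₂ := σ₁.setReg 16 (p * setWeight w X + 1) with hσ₂
  have hc₂ := hc₁.of_agreesOff ha₂ (by decide) (by decide)
  have hX₂ : Mask (σ₂.arr 4) X := by
    rw [ha₂.2 4 (by decide), ha₁.2 4 (by decide)]; exact hX
  have hp₂ : σ₂.reg 13 = p := by rw [ha₂.1 13 (by decide), ha₁.1 13 (by decide)]; exact hp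
  have hq₂ : σ₂.reg 14 = q := by rw [ha₂.1 14 (by decide), ha₁.1 14 (by decide)]; exact hq
  have hbig₂ : σ₂.reg 16 = p * setWeight w X + 1 := by simp [hσ₂, State.reg_setReg]
  have hele : ∀ u : Fin n, (if u ∈ X then w u * p else 0) ≤ t * t := by
    intro u; split_ifs
    · exact Nat.mul_le_mul (hwt u) hp'
    · omega
  have heval : ∀ u : Fin n, (if (u : ℕ) < n then 1 else 0) * σ₂.arr 4 u * σ₂.arr 0 u * p =
      if u ∈ X then w u * p else 0 := by
    intro u
    rw [hX₂ u, hc₂.weight u, if_pos u.2]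
    split_ifs <;> simp
  have heval' : ∀ k, ¬ k < n →
      (if k < n then 1 else 0) * σ₂.arr 4 k * σ₂.arr 0 k * p = 0 := by
    intro k hk; simp [hk]
  refine run_seq le_rfl (run_fill hM.roomy hb₂ (fun k => k)
    (fun k => (if k < n then 1 else 0) * σ₂.arr 4 k * σ₂.arr 0 k * p) hc₂.nodes (by decide)
    rfl rfl le_rfl (fun _ _ _ _ h => h) ?_ ?_) ?_
  · intro k _
    by_cases hk : k < n
    · have h3 := hele ⟨k, hk⟩
      have h4 := heval ⟨k, hk⟩
      simp only at h4 h3 ⊢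
      rw [h4]; omega
    · simp only [heval' k hk]; omega
  · intro k _ τ hr hi ha _
    simp [hi, hr 0 (by decide), hr 13 (by decide), hc₂.order, hp₂, ha 4 (by decide),
      ha 0 (by decide)]
  intro σ₃ hb₃ ha₃ h₃
  have hc₃ := hc₂.of_agreesOff ha₃ (by decide) (by decide)
  refine run_seq le_rfl (run_fill hM.roomy hb₃ (fun k => k) (fun _ => 0) hc₃.nodes (by decide)
    rfl rfl le_rfl (fun _ _ _ _ h => h) (by simp) (by intro k _ τ _ hi _ _; simp [hi])) ?_
  intro σ₄ hb₄ ha₄ h₄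
  have hc₄ := hc₃.of_agreesOff ha₄ (by decide) (by decide)
  have hX₄ : Mask (σ₄.arr 4) X := by
    rw [ha₄.2 4 (by decide), ha₃.2 4 (by decide)]; exact hX₂
  have hq₄ : σ₄.reg 14 = q := by rw [ha₄.1 14 (by decide), ha₃.1 14 (by decide)]; exact hq₂
  have hbig₄ : σ₄.reg 16 = p * setWeight w X + 1 := by
    rw [ha₄.1 16 (by decide), ha₃.1 16 (by decide)]; exact hbig₂
  set cap := capacity n σ₄ q (p * setWeight w X + 1) with hcap
  have hcle : ∀ a b, b < 2 * n + 1 → cap a b ≤ t * t + 1 := fun a b hb =>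
    capacity_le hc₄ hX₄ hb hbig fun v =>
      (Nat.mul_le_mul (hwt v) hq').trans (Nat.le_succ _)
  refine (run_fill hM.roomy hb₄ (fun k => k)
    (fun k => cap (k / (2 * n + 1)) (k - k / (2 * n + 1) * (2 * n + 1))) hc₄.cells (by decide)
    rfl rfl le_rfl (fun _ _ _ _ h => h) ?_ ?_).mono le_rfl ?_
  · intro k _
    have h6 : k - k / (2 * n + 1) * (2 * n + 1) < 2 * n + 1 := by
      rw [← Nat.mod_eq_sub_div_mul]; exact Nat.mod_lt _ (by omega)
    have := hcle (k / (2 * n + 1)) _ h6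
    omega
  · intro k _ τ hr hi ha _
    exact ⟨by simp [hi], fun _ => eval_capacityExpr hc₄ hr hi ha hq₄ hbig₄⟩
  intro σ₅ hb₅ ha₅ h₅
  have hr : ∀ a < 2 * n + 1, ∀ b < 2 * n + 1, (netOf n σ₅).r a b = cap a b := by
    intro a ha b hb
    have h6 : a * (2 * n + 1) + b < (2 * n + 1) * (2 * n + 1) := by nlinarith
    have h7 : (a * (2 * n + 1) + b) / (2 * n + 1) = a := by
      rw [mul_comm, Nat.mul_add_div (by omega), Nat.div_eq_of_lt hb, add_zero]
    have h8 := h₅.1 _ h6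
    simp only [h7, Nat.add_sub_cancel_left] at h8
    exact h8
  have he : ∀ k < 2 * n + 1, (netOf n σ₅).e k =
      (if k < n then 1 else 0) * σ₂.arr 4 k * σ₂.arr 0 k * p := by
    intro k hk
    simp only [netOf]
    rw [ha₅.2 8 (by decide), ha₄.2 8 (by decide)]
    exact h₃.1 k hk
  have hnet : IsBottleneckNet G w X p q (p * setWeight w X + 1) (netOf n σ₅) := by
    refine ⟨fun u v => ?_, fun v => ?_, fun u v => ?_, fun u => ?_, fun u v => ?_, fun u v => ?_,
      fun u => ?_, fun v => ?_, fun a ha => ?_⟩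
    · rw [hr _ (by omega) _ (by omega)]
      exact capacity_left hc₄ hX₄ _ _ u v
    · rw [hr _ (by omega) _ (by omega)]
      exact capacity_right hc₄ hX₄ _ _ v
    · rw [hr _ (by omega) _ (by omega)]
      exact capacity_eq_zero (by omega) (by omega)
    · rw [hr _ (by omega) _ (by omega)]
      exact capacity_eq_zero (by omega) (by omega)
    · rw [hr _ (by omega) _ (by omega)]
      exact capacity_eq_zero (by omega) (by omega)
    · rw [hr _ (by omega) _ (by omega)]
      exact capacity_eq_zero (by omega) (by omega)
    · rw [he _ (by omega)]; exact heval u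
    · rw [he _ (by omega)]; exact heval' _ (by omega)
    · simp only [netOf]
      rw [ha₅.2 9 (by decide)]
      exact h₄.1 a (by omega)
  refine ⟨hnet, ?_, fun a ha b hb => ?_⟩
  · rw [sum_range_two_mul_add_one]
    simp only [hnet.e_left, hnet.e_right, Finset.sum_const_zero, add_zero]
    rw [he _ (by omega), heval' _ (by omega), add_zero, ← Finset.sum_filter]
    have h6 : Finset.univ.filter (fun u => u ∈ X) = X := by ext; simp
    rw [h6, ← Finset.sum_mul]
    have h7 : (∑ i ∈ X, w i) * p ≤ t * t := Nat.mul_le_mul hXt hp'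
    omega
  · rw [hr _ (by omega) _ (by omega), hr _ (by omega) _ (by omega)]
    have h6 := hcle a b (by omega)
    have h7 := hcle b a (by omega)
    omega

theorem cell_inj {N x y a b : ℕ} (hy : y < N) (hb : b < N) :
    x * N + y = a * N + b ↔ x = a ∧ y = b := by
  constructor
  · intro h
    have h1 : x = a := by
      have := congrArg (· / N) h
      simp only [mul_comm _ N] at this
      rwa [Nat.mul_add_div (by omega), Nat.mul_add_div (by omega), Nat.div_eq_of_lt hy,
        Nat.div_eq_of_lt hb, add_zero, add_zero] at this
    subst h1
    exact ⟨rfl, by omega⟩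
  · rintro ⟨rfl, rfl⟩; rfl

/-! ### Pushes, discharges and sweeps in memory -/

/-- The memory holds the network `s`. -/
structure Holds (n : ℕ) (σ : State) (s : Net) : Prop where
  r : ∀ x ≤ 2 * n, ∀ y ≤ 2 * n, σ.arr 7 (x * (2 * n + 1) + y) = s.r x y
  e : ∀ x ≤ 2 * n, σ.arr 8 x = s.e x
  d : ∀ x ≤ 2 * n, σ.arr 9 x = s.d x

theorem Holds.of_arr_eq {s : Net} {σ' : State} (h : Holds n σ s) (h7 : σ'.arr 7 = σ.arr 7)
    (h8 : σ'.arr 8 = σ.arr 8) (h9 : σ'.arr 9 = σ.arr 9) : Holds n σ' s :=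
  ⟨by rw [h7]; exact h.r, by rw [h8]; exact h.e, by rw [h9]; exact h.d⟩

open Classical in
theorem run_pushCmd (hM : Ample w W M) (hσ : Bdd M σ) (hc : Ctx G w σ) {s : Net} {a b : ℕ}
    (hs : Holds n σ s) (hw : Net.Within (2 * n) M M s) (ha : σ.reg 9 = a) (hb : σ.reg 10 = b)
    (ha' : a ≤ 2 * n) (hb' : b ≤ 2 * n) :
    Run W M pushCmd σ 130 (fun τ => Holds n τ (s.push (2 * n) a b) ∧
      τ.reg 17 = if σ.reg 17 ≠ 0 ∨ (s.push (2 * n) a b).Admissible a b then 1 else 0) := by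
  have h2 := hM.pos
  have hw' := hw.push ha' hb'
  set δ := s.pushAmount (2 * n) a b with hδ
  have hδe := s.pushAmount_le_e (m := 2 * n) a b
  have hδr := s.pushAmount_le_r (m := 2 * n) a b
  rw [← hδ] at hδe hδr
  have hea := hw.e_le ha'
  have heb := hw.e_le hb'
  have hrab := hw.r a ha' b hb'
  -- The loop over heads also meets the tail itself. Then the two stores into each array hit the
  -- same cell, which is harmless because nothing is pushed.
  have hδ0 : a = b → δ = 0 := by rintro rfl; exact Net.pushAmount_self s a
  refine run_seq (T₁ := 40) (T₂ := 90) (Q₁ := fun τ => τ = σ.setReg 18 δ) (by norm_num) ?_ ?_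
  · have hev : ((read 9 (var 9)).eq (read 9 (var 10) + lit 1) * (read 9 (var 9)).lt (var 2) *
        (read 7 (var 9 * var 2 + var 10) -
          (read 7 (var 9 * var 2 + var 10) - read 8 (var 9)))).eval σ = δ := by
      simp only [Expr.eval_mul, Expr.eval_eq, Expr.eval_lt, Expr.eval_read, Expr.eval_var,
        Expr.eval_add, Expr.eval_sub, Expr.eval_lit, ha, hb, hc.nodes, hs.d a ha', hs.d b hb',
        hs.e a ha', hs.r a ha' b hb', hδ, Net.pushAmount]
      split_ifs <;> simp_all <;> omega
    exact run_assign hM.roomy hσ rfl (by decide) (by rw [hev]; omega) (by rw [hev])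
  rintro _ hb₁ - rfl
  have hab' : (a * (2 * n + 1) + b = b * (2 * n + 1) + a) ↔ a = b := by
    rw [cell_inj (by omega) (by omega)]; omega
  refine run_seq (T₁ := 15) (T₂ := 75)
    (Q₁ := fun τ => τ = (σ.setReg 18 δ).setArr 7 (a * (2 * n + 1) + b) (s.r a b - δ))
    (by norm_num) (run_store hM.roomy hb₁ rfl rfl (by decide) ?_ ?_) ?_
  · simp [State.reg_setReg, ha, hb, hc.nodes, hs.r a ha' b hb']; omega
  · simp [State.reg_setReg, ha, hb, hc.nodes, hs.r a ha' b hb']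
  rintro _ hb₂ - rfl
  set σ₂ := (σ.setReg 18 δ).setArr 7 (a * (2 * n + 1) + b) (s.r a b - δ) with hσ₂
  have hr₂ : σ₂.reg = (σ.setReg 18 δ).reg := rfl
  have hv₂ : σ₂.arr 7 (b * (2 * n + 1) + a) + δ = s.r b a + δ := by
    rw [hσ₂, State.arr_setArr]
    by_cases hab : a = b
    · subst hab; simp [hδ0 rfl]
    · rw [if_neg fun h => hab (hab'.1 h.2.symm)]
      exact congrArg (· + δ) (hs.r b hb' a ha')
  refine run_seq (T₁ := 15) (T₂ := 60)
    (Q₁ := fun τ => τ = σ₂.setArr 7 (b * (2 * n + 1) + a) (s.r b a + δ))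
    (by norm_num) (run_store hM.roomy hb₂ rfl rfl (by decide) ?_ ?_) ?_
  · simp only [Expr.eval_add, Expr.eval_read, Expr.eval_mul, Expr.eval_var, hr₂]
    simp only [State.reg_setReg, ha, hb, hc.nodes]
    simp [hv₂]; omega
  · simp only [Expr.eval_add, Expr.eval_read, Expr.eval_mul, Expr.eval_var, hr₂]
    simp only [State.reg_setReg, ha, hb, hc.nodes]
    simp [hv₂]
  rintro _ hb₃ - rfl
  set σ₃ := σ₂.setArr 7 (b * (2 * n + 1) + a) (s.r b a + δ) with hσ₃
  have hr₃ : σ₃.reg = (σ.setReg 18 δ).reg := rfl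
  have he₃ : σ₃.arr 8 = σ.arr 8 := by
    funext j; simp [hσ₃, hσ₂, State.arr_setArr]
  refine run_seq (T₁ := 15) (T₂ := 45) (Q₁ := fun τ => τ = σ₃.setArr 8 a (s.e a - δ))
    (by norm_num) (run_store hM.roomy hb₃ rfl rfl (by decide) ?_ ?_) ?_
  · simp [hr₃, State.reg_setReg, ha, he₃, hs.e a ha']; omega
  · simp [hr₃, State.reg_setReg, ha, he₃, hs.e a ha']
  rintro _ hb₄ - rfl
  set σ₄ := σ₃.setArr 8 a (s.e a - δ) with hσ₄
  have hr₄ : σ₄.reg = (σ.setReg 18 δ).reg := rfl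
  have hv₄ : σ₄.arr 8 b + δ = s.e b + δ := by
    rw [hσ₄, State.arr_setArr]
    by_cases hab : a = b
    · subst hab; simp [hδ0 rfl]
    · rw [if_neg (by simp [Ne.symm hab]), he₃, hs.e b hb']
  -- Since `δ ≤ s.e a`, the new excess is at most the sum of two old ones, hence at most the total
  -- excess.
  have hebδ : s.e b + δ ≤ M := by
    by_cases hab : a = b
    · rw [hδ0 hab]; omega
    · have h3 := Finset.add_le_sum (f := s.e) (fun _ _ => Nat.zero_le _)
        (Finset.mem_range.2 (show a < 2 * n + 1 by omega))
        (Finset.mem_range.2 (show b < 2 * n + 1 by omega)) hab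
      have := hw.e
      omega
  refine run_seq (T₁ := 15) (T₂ := 30) (Q₁ := fun τ => τ = σ₄.setArr 8 b (s.e b + δ))
    (by norm_num) (run_store hM.roomy hb₄ rfl rfl (by decide) ?_ ?_) ?_
  · simp [hr₄, State.reg_setReg, hb, hv₄]; omega
  · simp [hr₄, State.reg_setReg, hb, hv₄]
  rintro _ hb₅ - rfl
  set σ₅ := σ₄.setArr 8 b (s.e b + δ) with hσ₅
  have hr₅ : σ₅.reg = (σ.setReg 18 δ).reg := rfl
  have hd₅ : σ₅.arr 9 = σ.arr 9 := by
    funext j; simp [hσ₅, hσ₄, hσ₃, hσ₂, State.arr_setArr]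
  have hH : Holds n σ₅ (s.push (2 * n) a b) := by
    refine ⟨fun x hx y hy => ?_, fun x hx => ?_, fun x hx => ?_⟩
    · have h7 : σ₅.arr 7 = σ₃.arr 7 := by
        funext j; simp [hσ₅, hσ₄, State.arr_setArr]
      rw [h7, hσ₃, State.arr_setArr, hσ₂, State.arr_setArr]
      simp only [true_and, cell_inj (show y < 2 * n + 1 by omega) (show a < 2 * n + 1 by omega),
        cell_inj (show y < 2 * n + 1 by omega) (show b < 2 * n + 1 by omega), Net.push, ← hδ,
        State.arr_setReg, hs.r x hx y hy]
    · rw [hσ₅, State.arr_setArr, hσ₄, State.arr_setArr, he₃]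
      simp only [true_and, Net.push, ← hδ, hs.e x hx]
    · rw [hd₅]; exact hs.d x hx
  have hev : ((lit 0).lt (var 17 + (read 9 (var 9)).eq (read 9 (var 10) + lit 1) *
      read 7 (var 9 * var 2 + var 10))).eval σ₅ =
      if σ.reg 17 ≠ 0 ∨ (s.push (2 * n) a b).Admissible a b then 1 else 0 := by
    have h9 : σ₅.reg 9 = a := by rw [hr₅, State.reg_setReg]; simp [ha]
    have h10 : σ₅.reg 10 = b := by rw [hr₅, State.reg_setReg]; simp [hb]
    have h17 : σ₅.reg 17 = σ.reg 17 := by rw [hr₅, State.reg_setReg]; simp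
    have h2' : σ₅.reg 2 = 2 * n + 1 := by rw [hr₅, State.reg_setReg]; simp [hc.nodes]
    simp only [Expr.eval_lt, Expr.eval_lit, Expr.eval_add, Expr.eval_var, Expr.eval_mul,
      Expr.eval_eq, Expr.eval_read, h9, h10, h17, h2', hH.r a ha' b hb', hH.d a ha', hH.d b hb']
    refine if_congr ?_ rfl rfl
    unfold Net.Admissible
    split_ifs with h <;> simp [h] <;> omega
  refine run_assign hM.roomy hb₅ rfl (by decide) ?_ ⟨hH.of_arr_eq rfl rfl rfl, ?_⟩
  · rw [hev]; split_ifs <;> omega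
  · rw [hev]; simp [State.reg_setReg]

/-- A push to `k` leaves the arcs from `a` to earlier heads alone, so a flag computed during the
pushes is still right when the relabel is decided. -/
theorem pushes_admissible_iff {m : ℕ} (s : Net) {a k b : ℕ} (hb : b < k) :
    ((s.pushes m a (k + 1)).Admissible a b) ↔ (s.pushes m a k).Admissible a b := by
  simp only [Net.Admissible, Net.pushes_d]
  rw [Net.pushes, Net.push_r_of_ne (by omega)]

open Classical in
theorem run_dischargeCmd (hM : Ample w W M) (hσ : Bdd M σ) (hc : Ctx G w σ) {s : Net} {a : ℕ}
    (hs : Holds n σ s) (hw : Net.Within (2 * n) M M s) (ha : σ.reg 9 = a) (ha' : a < 2 * n) :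
    Run W M dischargeCmd σ (200 * (2 * n + 1)) (fun τ => Holds n τ (s.discharge (2 * n) a)) := by
  have h2 := hM.pos
  have hn := hM.nodes
  refine run_seq (T₁ := 2) (T₂ := ((2 * n + 1) * (130 + 8) + 6) + 20)
    (Q₁ := fun τ => τ = σ.setReg 17 0) (by omega)
    (run_assign hM.roomy hσ rfl (by decide) (by simp) rfl) ?_
  rintro _ hb₁ ha₁ rfl
  have hc₁ := hc.of_agreesOff ha₁ (by decide) (by decide)
  refine run_seq le_rfl (run_forLoop (T := 130) hM.roomy hb₁
    (fun k τ => Holds n τ (s.pushes (2 * n) a k) ∧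
      τ.reg 17 = if ∃ b < k, (s.pushes (2 * n) a k).Admissible a b then 1 else 0)
    hc₁.nodes (by decide) (by decide) le_rfl
    (fun _ τ v h => ⟨h.1.of_arr_eq rfl rfl rfl, by rw [State.reg_setReg, if_neg (by decide)]; exact h.2⟩)
    ⟨hs.of_arr_eq rfl rfl rfl, by simp [State.reg_setReg]⟩ ?_) ?_
  · intro k hk τ hbτ haτ hiτ hI
    have hcτ := hc₁.of_agreesOff haτ (by decide) (by decide)
    have h9 : τ.reg 9 = a := by rw [haτ.1 9 (by decide)]; simpa [State.reg_setReg] using ha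
    refine (run_pushCmd hM hbτ hcτ hI.1 (hw.pushes ha'.le hk.le) h9 hiτ ha'.le
      (by omega)).mono le_rfl ?_
    rintro ρ - - ⟨hρ, hρ'⟩
    refine ⟨hρ, ?_⟩
    rw [hρ', hI.2]
    refine if_congr ?_ rfl rfl
    constructor
    · rintro (h | h)
      · obtain ⟨b, hb, h'⟩ : ∃ b < k, (s.pushes (2 * n) a k).Admissible a b := by
          by_contra hno; exact h (if_neg hno)
        exact ⟨b, by omega, (pushes_admissible_iff s hb).2 h'⟩
      · exact ⟨k, by omega, h⟩
    · rintro ⟨b, hb, h⟩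
      rcases Nat.lt_succ_iff_lt_or_eq.1 hb with hb' | rfl
      · left
        rw [if_pos ⟨b, hb', (pushes_admissible_iff s hb').1 h⟩]; simp
      · exact Or.inr h
  rintro σ₂ hb₂ ha₂ ⟨hH, hflag⟩
  have hc₂ := hc₁.of_agreesOff ha₂ (by decide) (by decide)
  have h9 : σ₂.reg 9 = a := by rw [ha₂.1 9 (by decide)]; simpa [State.reg_setReg] using ha
  have hev : (read 9 (var 9) + (var 17).eq (lit 0) * (read 9 (var 9)).lt (var 2)).eval σ₂ =
      (s.discharge (2 * n) a).d a := by
    simp only [Expr.eval_add, Expr.eval_read, Expr.eval_var, Expr.eval_mul, Expr.eval_eq,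
      Expr.eval_lit, Expr.eval_lt, h9, hflag, hc₂.nodes, hH.d a ha'.le, Net.discharge, Net.relabel]
    split_ifs <;> simp_all
  refine run_store hM.roomy hb₂ rfl rfl (by decide) ?_ ?_
  · have h3 : (read 9 (var 9) + (var 17).eq (lit 0) * (read 9 (var 9)).lt (var 2)).eval σ₂ ≤
        max (σ₂.arr 9 a) (2 * n + 1) := by
      simp only [Expr.eval_add, Expr.eval_read, Expr.eval_var, Expr.eval_mul, Expr.eval_eq,
        Expr.eval_lit, Expr.eval_lt, h9, hc₂.nodes]
      by_cases h17 : σ₂.reg 17 = 0 <;> by_cases hlt : σ₂.arr 9 a < 2 * n + 1 <;>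
        simp only [h17, hlt, if_true, if_false] <;> omega
    have h4 := hb₂.2 9 a
    refine h3.trans (max_le h4 ?_)
    nlinarith
  · rw [hev, Expr.eval_var, h9]
    refine ⟨fun x hx y hy => ?_, fun x hx => ?_, fun x hx => ?_⟩
    · rw [State.arr_setArr, if_neg (by simp)]; exact hH.r x hx y hy
    · rw [State.arr_setArr, if_neg (by simp)]; exact hH.e x hx
    · rw [State.arr_setArr]
      by_cases hxa : x = a
      · subst hxa; simp
      · rw [if_neg (by simp [hxa]), hH.d x hx]
        simp [Net.discharge, Net.relabel, hxa]

theorem run_sweepCmd (hM : Ample w W M) (hσ : Bdd M σ) (hc : Ctx G w σ) {s : Net}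
    (hs : Holds n σ s) (hw : Net.Within (2 * n) M M s) :
    Run W M sweepCmd σ (220 * (2 * n + 1) ^ 2) (fun τ => Holds n τ (s.sweep (2 * n))) := by
  refine run_forLoop (T := 200 * (2 * n + 1)) hM.roomy hσ
    (fun k τ => Holds n τ (s.sweepTo (2 * n) k)) hc.sink (by decide) (by decide)
    (by nlinarith) (fun _ _ _ h => h.of_arr_eq rfl rfl rfl) hs ?_
  intro k hk τ hb ha hi hI
  exact run_dischargeCmd hM hb (hc.of_agreesOff ha (by decide) (by decide)) hI
    (hw.sweepTo hk.le) hi hk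

theorem run_sweeps (hM : Ample w W M) (hσ : Bdd M σ) (hc : Ctx G w σ) {s : Net}
    (hs : Holds n σ s) (hw : Net.Within (2 * n) M M s) :
    Run W M (forLoop 8 4 sweepCmd) σ (500 * (2 * n + 1) ^ 4) (fun τ =>
      Holds n τ ((Net.sweep (2 * n))^[2 * ((2 * n + 1) * (2 * n + 1))] s)) := by
  refine run_forLoop (T := 220 * (2 * n + 1) ^ 2) hM.roomy hσ
    (fun k τ => Holds n τ ((Net.sweep (2 * n))^[k] s)) hc.sweeps (by decide) (by decide)
    ?_ (fun _ _ _ h => h.of_arr_eq rfl rfl rfl) hs ?_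
  · have h1 : 1 ≤ (2 * n + 1) ^ 2 := Nat.one_le_pow _ _ (by omega)
    have h2 : (2 * n + 1) ^ 4 = (2 * n + 1) ^ 2 * (2 * n + 1) ^ 2 := by ring
    have h3 : (2 * n + 1) * (2 * n + 1) = (2 * n + 1) ^ 2 := by ring
    rw [h2, h3]
    nlinarith
  · intro k hk τ hb ha hi hI
    rw [Function.iterate_succ_apply']
    exact run_sweepCmd hM hb (hc.of_agreesOff ha (by decide) (by decide)) hI (hw.iterate_sweep k)

theorem run_ratioStepCmd (hM : Ample w W M) (hσ : Bdd M σ) (hc : Ctx G w σ)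
    (hX : Mask (σ.arr 4) X) (hS : Mask (σ.arr 5) S) :
    Run W M ratioStepCmd σ (4000 * (2 * n + 1) ^ 4) (fun τ =>
      ∃ L, Mask (τ.arr 5) L ∧ IsRatioStep G w X S L) := by
  classical
  have hpow : (2 * n + 1) ^ 2 ≤ (2 * n + 1) ^ 4 := Nat.pow_le_pow_right (by omega) (by norm_num)
  have hn2 : 2 * n + 1 ≤ (2 * n + 1) ^ 2 := Nat.le_self_pow (by norm_num) _
  have hMn := hM.nodes
  have hM2 := hM.pos
  refine run_seq (T₁ := 700 * (2 * n + 1) ^ 2)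
    (T₂ := 2000 * (2 * n + 1) ^ 2 + (500 * (2 * n + 1) ^ 4 + (n * 300 + 6))) (by omega)
    (run_statsCmd hM hσ hc hX hS) ?_
  rintro σ₁ hb₁ ha₁ ⟨-, hp, hq⟩
  have hc₁ := hc.of_agreesOff ha₁ (by decide) (by decide)
  have hX₁ : Mask (σ₁.arr 4) X := by rw [ha₁.2 4 (by decide)]; exact hX
  refine run_seq le_rfl (run_buildCmd hM hb₁ hc₁ hX₁ hp hq
    (setWeight_mono w (Finset.subset_univ _)) (setWeight_mono w (Finset.subset_univ _))) ?_
  rintro σ₂ hb₂ ha₂ ⟨hnet, hwithin⟩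
  have hc₂ := hc₁.of_agreesOff ha₂ (by decide) (by decide)
  have hX₂ : Mask (σ₂.arr 4) X := by rw [ha₂.2 4 (by decide)]; exact hX₁
  refine run_seq le_rfl (run_sweeps hM hb₂ hc₂ (s := netOf n σ₂)
    ⟨fun _ _ _ _ => rfl, fun _ _ => rfl, fun _ _ => rfl⟩ hwithin) ?_
  intro σ₃ hb₃ ha₃ hH
  have hc₃ := hc₂.of_agreesOff ha₃ (by decide) (by decide)
  have hX₃ : Mask (σ₃.arr 4) X := by rw [ha₃.2 4 (by decide)]; exact hX₂
  have hmin := hnet.isMaxMinimizer_sweep (Nat.lt_succ_self _)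
    (t := 2 * ((2 * n + 1) * (2 * n + 1))) (by rw [mul_assoc])
  refine (run_fill hM.roomy hb₃ (fun k => k)
    (fun k => σ₃.arr 4 k * (if σ₃.arr 9 k = 2 * n + 1 then 1 else 0)) hc₃.order (by decide)
    rfl rfl le_rfl (fun _ _ _ _ h => h) ?_ ?_).mono le_rfl ?_
  · intro k hk
    have h4 := hX₃ ⟨k, hk⟩
    simp only at h4 ⊢
    rw [h4]; split_ifs <;> omega
  · intro k _ τ hr hi ha _
    simp [hi, hr 2 (by decide), hc₃.nodes, ha 4 (by decide), ha 9 (by decide)]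
  rintro τ - - ⟨hτ, -⟩
  refine ⟨_, fun v => ?_, hmin⟩
  rw [hτ v v.2, hX₃ v, hH.d v (by omega)]
  simp only [Finset.mem_filter]
  split_ifs <;> simp_all

/-! ### Rounds of the decomposition -/

theorem run_ratioSteps (hM : Ample w W M) (hσ : Bdd M σ) (hc : Ctx G w σ)
    (hX : Mask (σ.arr 4) X) (hS : Mask (σ.arr 5) X) :
    Run W M (forLoop 7 5 ratioStepCmd) σ (5000 * (2 * n + 1) ^ 5) (fun τ =>
      ∃ S : ℕ → Finset (Fin n), S 0 = X ∧ Mask (τ.arr 5) (S (n + 1)) ∧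
        ∀ i ≤ n, IsRatioStep G w X (S i) (S (i + 1))) := by
  classical
  refine (run_forLoop (T := 4000 * (2 * n + 1) ^ 4) hM.roomy hσ
    (fun k τ => ∃ S : ℕ → Finset (Fin n), S 0 = X ∧ Mask (τ.arr 5) (S k) ∧
        ∀ i < k, IsRatioStep G w X (S i) (S (i + 1))) hc.steps (by decide) (by decide) ?_
    (fun _ _ _ h => h) ⟨fun _ => X, rfl, hS, fun i hi => absurd hi (Nat.not_lt_zero i)⟩
    ?_).mono le_rfl ?_
  · have h1 : 1 ≤ (2 * n + 1) ^ 4 := Nat.one_le_pow _ _ (by omega)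
    have h2 : (2 * n + 1) ^ 5 = (2 * n + 1) ^ 4 * (2 * n + 1) := by ring
    rw [h2]
    nlinarith
  · rintro k hk τ hb ha - ⟨S, h0, hm, hst⟩
    refine (run_ratioStepCmd hM hb (hc.of_agreesOff ha (by decide) (by decide))
      (by rw [ha.2 4 (by decide)]; exact hX) hm).mono le_rfl ?_
    rintro ρ - - ⟨L, hL, hstep⟩
    -- The sequence of ratio steps is prolonged by one term in each pass; its later values are
    -- irrelevant.
    refine ⟨Function.update S (k + 1) L, ?_, ?_, ?_⟩
    · rw [Function.update_of_ne (by omega)]; exact h0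
    · rw [Function.update_self]; exact hL
    · intro i hi
      rw [Function.update_of_ne (by omega)]
      rcases Nat.lt_succ_iff_lt_or_eq.1 hi with h | rfl
      · rw [Function.update_of_ne (by omega)]; exact hst i h
      · rw [Function.update_self]; exact hstep
  · rintro τ - - ⟨S, h0, hm, hst⟩
    exact ⟨S, h0, hm, fun i hi => hst i (by omega)⟩

/-- The memory displays `L`, and any decomposition of the whole graph is `L` followed by a
decomposition of the graph induced on `X`. -/
structure Progress (G : SimpleGraph (Fin n)) (w : Fin n → ℕ) (σ : State) (X : Finset (Fin n))
    (L : List (Finset (Fin n) × Finset (Fin n))) : Prop where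
  remaining : Mask (σ.arr 4) X
  shown : DisplaysPairs σ L
  iff : ∀ L', IsBottleneckDecomposition G w Finset.univ L' ↔
    ∃ L'', L' = L ++ L'' ∧ IsBottleneckDecomposition G w X L''

/-- A round on a nonempty `X` removes at least the bottleneck, so `n` rounds exhaust the graph. A
round on `X = ∅` finds `B = ∅` and keeps `X` and `L`. The bound on `L.length` keeps the pair counter
below `n` before its update. -/
theorem run_roundCmd (hM : Ample w W M) (hw : ∀ v, 0 < w v) (hσ : Bdd M σ) (hc : Ctx G w σ)
    {k : ℕ} (hk : k < n) (hcard : X.card + k ≤ n) {L : List (Finset (Fin n) × Finset (Fin n))}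
    (hL : L.length ≤ k) (hP : Progress G w σ X L) :
    Run W M roundCmd σ (8000 * (2 * n + 1) ^ 5) (fun τ => ∃ X' L', X'.card + (k + 1) ≤ n ∧
      L'.length ≤ k + 1 ∧ Progress G w τ X' L') := by
  classical
  have hM2 := hM.pos
  have hMn := hM.nodes
  have hpow : (2 * n + 1) ^ 2 ≤ (2 * n + 1) ^ 5 := Nat.pow_le_pow_right (by omega) (by norm_num)
  have hn2 : 2 * n + 1 ≤ (2 * n + 1) ^ 2 := Nat.le_self_pow (by norm_num) _
  have hX := hP.remaining
  have hbit : ∀ {f : ℕ → ℕ} {A : Finset (Fin n)}, Mask f A → ∀ k < n, f k ≤ M := by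
    intro f A h k hk
    have := h ⟨k, hk⟩
    simp only at this
    rw [this]; split_ifs <;> omega
  refine run_seq (T₁ := n * 300 + 6) (T₂ := 5000 * (2 * n + 1) ^ 5 + (700 * (2 * n + 1) ^ 2 +
      ((n * 300 + 6) + ((n * 300 + 6) + ((n * 300 + 6) + 7))))) (by omega)
    (run_fill hM.roomy hσ (fun k => k) (fun k => σ.arr 4 k) hc.order (by decide)
    rfl rfl le_rfl (fun _ _ _ _ h => h) (fun k hk => hbit hX k hk)
    (by intro k _ τ hr hi ha _; simp [hi, ha 4 (by decide)])) ?_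
  rintro σ₁ hb₁ ha₁ ⟨h₁, -⟩
  have hc₁ := hc.of_agreesOff ha₁ (by decide) (by decide)
  have hX₁ : Mask (σ₁.arr 4) X := by rw [ha₁.2 4 (by decide)]; exact hX
  have hS₁ : Mask (σ₁.arr 5) X := fun v => (h₁ v v.2).trans (hX v)
  refine run_seq le_rfl (run_ratioSteps hM hb₁ hc₁ hX₁ hS₁) ?_
  rintro σ₂ hb₂ ha₂ ⟨S, hS0, hSn, hstep⟩
  have hc₂ := hc₁.of_agreesOff ha₂ (by decide) (by decide)
  have hX₂ : Mask (σ₂.arr 4) X := by rw [ha₂.2 4 (by decide)]; exact hX₁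
  set B := S (n + 1) with hB
  refine run_seq le_rfl (run_statsCmd hM hb₂ hc₂ hX₂ hSn) ?_
  rintro σ₃ hb₃ ha₃ ⟨hC₃, -, hq₃⟩
  have hc₃ := hc₂.of_agreesOff ha₃ (by decide) (by decide)
  have hX₃ : Mask (σ₃.arr 4) X := by rw [ha₃.2 4 (by decide)]; exact hX₂
  have hB₃ : Mask (σ₃.arr 5) B := by rw [ha₃.2 5 (by decide)]; exact hSn
  set C := nbhdIn G X B with hC
  have hk₃ : σ₃.reg 1 = L.length := by
    rw [ha₃.1 1 (by decide), ha₂.1 1 (by decide), ha₁.1 1 (by decide)]; exact hP.shown.1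
  set l := L.length with hl
  refine run_seq le_rfl (run_fill hM.roomy hb₃ (fun j => l * n + j) (fun j => σ₃.arr 5 j)
    hc₃.order (by decide) rfl rfl le_rfl (fun _ _ _ _ h => by omega)
    (fun k hk => hbit hB₃ k hk) (by
      intro k _ τ hr hi ha _
      simp [hi, ha 5 (by decide), hr 1 (by decide), hk₃, hr 0 (by decide), hc₃.order])) ?_
  rintro σ₄ hb₄ ha₄ ⟨h₄, h₄'⟩
  have hc₄ := hc₃.of_agreesOff ha₄ (by decide) (by decide)
  have hC₄ : Mask (σ₄.arr 6) C := by rw [ha₄.2 6 (by decide)]; exact hC₃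
  have hk₄ : σ₄.reg 1 = l := by rw [ha₄.1 1 (by decide)]; exact hk₃
  refine run_seq le_rfl (run_fill hM.roomy hb₄ (fun j => l * n + j) (fun j => σ₄.arr 6 j)
    hc₄.order (by decide) rfl rfl le_rfl (fun _ _ _ _ h => by omega)
    (fun k hk => hbit hC₄ k hk) (by
      intro k _ τ hr hi ha _
      simp [hi, ha 6 (by decide), hr 1 (by decide), hk₄, hr 0 (by decide), hc₄.order])) ?_
  rintro σ₅ hb₅ ha₅ ⟨h₅, h₅'⟩
  have hc₅ := hc₄.of_agreesOff ha₅ (by decide) (by decide)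
  have hX₅ : Mask (σ₅.arr 4) X := by
    rw [ha₅.2 4 (by decide), ha₄.2 4 (by decide)]; exact hX₃
  have hB₅ : Mask (σ₅.arr 5) B := by
    rw [ha₅.2 5 (by decide), ha₄.2 5 (by decide)]; exact hB₃
  have hC₅ : Mask (σ₅.arr 6) C := by rw [ha₅.2 6 (by decide)]; exact hC₄
  have hrest : ∀ v : Fin n, σ₅.arr 4 v * (if σ₅.arr 5 v + σ₅.arr 6 v = 0 then 1 else 0) =
      if v ∈ X \ (B ∪ C) then 1 else 0 := by
    intro v
    rw [hX₅ v, hB₅ v, hC₅ v]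
    by_cases h1 : v ∈ X <;> by_cases h2 : v ∈ B <;> by_cases h3 : v ∈ C <;> simp [h1, h2, h3]
  refine run_seq le_rfl (run_fill hM.roomy hb₅ (fun j => j)
    (fun j => σ₅.arr 4 j * (if σ₅.arr 5 j + σ₅.arr 6 j = 0 then 1 else 0))
    hc₅.order (by decide) rfl rfl le_rfl (fun _ _ _ _ h => h)
    (fun j hj => by
      have := hrest ⟨j, hj⟩
      simp only at this ⊢
      rw [this]; split_ifs <;> omega)
    (by
      intro k _ τ hr hi ha h4
      refine ⟨by simp [hi], fun _ => ?_⟩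
      simp only [Expr.eval_mul, Expr.eval_read, Expr.eval_var, Expr.eval_eq, Expr.eval_add,
        Expr.eval_lit, hi, h4, ha 5 (by decide), ha 6 (by decide)])) ?_
  rintro σ₆ hb₆ ha₆ ⟨h₆, -⟩
  have hrest₆ : Mask (σ₆.arr 4) (X \ (B ∪ C)) := fun v => (h₆ v v.2).trans (hrest v)
  have hk₆ : σ₆.reg 1 = l := by
    rw [ha₆.1 1 (by decide), ha₅.1 1 (by decide)]; exact hk₄
  have hq₆ : σ₆.reg 14 = setWeight w B := by
    rw [ha₆.1 14 (by decide), ha₅.1 14 (by decide), ha₄.1 14 (by decide)]; exact hq₃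
  have hev : (var 1 + (lit 0).lt (var 14)).eval σ₆ = l + if B.Nonempty then 1 else 0 := by
    simp only [Expr.eval_add, Expr.eval_var, Expr.eval_lt, Expr.eval_lit, hk₆, hq₆]
    congr 1
    refine if_congr ⟨fun h => ?_, fun h => setWeight_pos w hw h⟩ rfl rfl
    by_contra hne
    rw [Finset.not_nonempty_iff_eq_empty] at hne
    rw [hne] at h
    simp [setWeight] at h
  -- Only row `l` is written. In the idle rounds this row lies just past the displayed ones.
  have h2 : ∀ i < l, ∀ v : Fin n, σ₆.arr 2 (i * n + v) = σ.arr 2 (i * n + v) := by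
    intro i hi v
    rw [ha₆.2 2 (by decide), ha₅.2 2 (by decide), h₄' _ (by
        intro j hj h
        have : (i + 1) * n ≤ l * n := Nat.mul_le_mul_right n hi
        have := v.2
        nlinarith), ha₃.2 2 (by decide), ha₂.2 2 (by decide), ha₁.2 2 (by decide)]
  have h3 : ∀ i < l, ∀ v : Fin n, σ₆.arr 3 (i * n + v) = σ.arr 3 (i * n + v) := by
    intro i hi v
    rw [ha₆.2 3 (by decide), h₅' _ (by
        intro j hj h
        have : (i + 1) * n ≤ l * n := Nat.mul_le_mul_right n hi
        have := v.2
        nlinarith), ha₄.2 3 (by decide), ha₃.2 3 (by decide), ha₂.2 3 (by decide),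
      ha₁.2 3 (by decide)]
  have h2' : ∀ v : Fin n, σ₆.arr 2 (l * n + v) = if v ∈ B then 1 else 0 := by
    intro v
    rw [ha₆.2 2 (by decide), ha₅.2 2 (by decide), h₄ v v.2]; exact hB₃ v
  have h3' : ∀ v : Fin n, σ₆.arr 3 (l * n + v) = if v ∈ C then 1 else 0 := by
    intro v
    rw [ha₆.2 3 (by decide), h₅ v v.2]; exact hC₄ v
  refine run_assign hM.roomy hb₆ rfl (by decide) ?_ ?_
  · rw [hev]; split_ifs <;> nlinarith
  rw [hev]
  rcases X.eq_empty_or_nonempty with hXe | hXn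
  · have hBe : B = ∅ := Finset.subset_empty.1 (hXe ▸ (hstep n le_rfl).1)
    have hXX : X \ (B ∪ C) = X := by rw [hXe]; simp
    refine ⟨X, L, by rw [hXe]; simp; omega, by omega, hXX ▸ hrest₆, ⟨?_, ?_⟩, hP.iff⟩
    · simp [State.reg_setReg, hBe, hl]
    · intro i v
      simp only [State.arr_setReg]
      rw [h2 i i.2 v, h3 i i.2 v]
      exact hP.shown.2 i v
  · obtain ⟨hmax, huniq⟩ := isMaximalBottleneck_of_ratioSteps hw hXn hS0 (by omega) hstep
    rw [← hB] at hmax huniq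
    have hBn := hmax.1.2.1
    have hlt : (X \ (B ∪ C)).card < X.card := by
      obtain ⟨b, hb⟩ := hBn
      refine Finset.card_lt_card (Finset.ssubset_iff_subset_ne.2 ⟨Finset.sdiff_subset, fun h => ?_⟩)
      have hbX := hmax.1.1 hb
      rw [← h] at hbX
      simp [hb] at hbX
    refine ⟨X \ (B ∪ C), L ++ [(B, C)], by omega, by simp; omega, hrest₆, ⟨?_, ?_⟩, fun L' => ?_⟩
    · simp [State.reg_setReg, hBn, hl]
    · intro i v
      simp only [State.arr_setReg]
      by_cases hi : (i : ℕ) < l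
      · rw [h2 i hi v, h3 i hi v]
        have := hP.shown.2 ⟨i, hi⟩ v
        simpa [List.getElem_append_left hi] using this
      · have hil : (i : ℕ) = l := by
          have := i.2
          simp at this
          omega
        rw [hil, h2' v, h3' v]
        simp [List.get_eq_getElem, hil, hl]
    · rw [hP.iff L']
      constructor
      · rintro ⟨L'', rfl, h⟩
        obtain ⟨L₃, rfl, h'⟩ := (isBottleneckDecomposition_iff hXn hmax huniq).1 h
        refine ⟨L₃, by simp [hC], ?_⟩
        convert h'
      · rintro ⟨L'', rfl, h⟩
        refine ⟨(B, C) :: L'', by simp, (isBottleneckDecomposition_iff hXn hmax huniq).2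
          ⟨L'', rfl, ?_⟩⟩
        convert h

theorem run_decompositionCmd (hM : Ample w W M) (hw : ∀ v, 0 < w v)
    (hb : Bdd M (graphInput G w)) :
    Run W M decompositionCmd (graphInput G w) (9000 * (2 * n + 1) ^ 6) (fun τ => ∃ L,
      DisplaysPairs τ L ∧ ∀ L', IsBottleneckDecomposition G w Finset.univ L' ↔ L' = L) := by
  classical
  have hM2 := hM.pos
  have hMn := hM.nodes
  set σ₀ := graphInput G w with hσ₀
  have hn0 : σ₀.reg 0 = n := by simp [hσ₀, graphInput]
  have hpow : (2 * n + 1) ≤ (2 * n + 1) ^ 6 := Nat.le_self_pow (by norm_num) _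
  have hNN : 2 * n + 1 ≤ (2 * n + 1) * (2 * n + 1) := Nat.le_mul_self _
  refine run_seq (T₁ := 6) (T₂ := 5 + (5 + (5 + (5 + ((n * 300 + 6) +
      (n * (8000 * (2 * n + 1) ^ 5 + 8) + 6))))))
    (Q₁ := fun τ => τ = σ₀.setReg 2 (2 * n + 1)) ?_
    (run_assign hM.roomy hb rfl (by decide) (by simp [hn0]; omega) (by simp [hn0])) ?_
  · have h1 : (2 * n + 1) ^ 6 = (2 * n + 1) ^ 5 * (2 * n + 1) := by ring
    have h2 : 2 * n + 1 ≤ (2 * n + 1) ^ 5 := Nat.le_self_pow (by norm_num) _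
    rw [h1]; nlinarith
  rintro _ hb₁ - rfl
  set σ₁ := σ₀.setReg 2 (2 * n + 1) with hσ₁
  have e₁ : (lit 2 * var 0).eval σ₁ = 2 * n := by simp [hσ₁, State.reg_setReg, hn0]
  refine run_seq le_rfl (Q₁ := fun τ => τ = σ₁.setReg 3 (2 * n))
    (run_assign hM.roomy hb₁ rfl (by decide) (by rw [e₁]; omega) (by rw [e₁])) ?_
  rintro _ hb₂ - rfl
  set σ₂ := σ₁.setReg 3 (2 * n) with hσ₂
  have e₂ : (var 2 * var 2).eval σ₂ = (2 * n + 1) * (2 * n + 1) := by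
    simp [hσ₂, hσ₁, State.reg_setReg]
  refine run_seq le_rfl (Q₁ := fun τ => τ = σ₂.setReg 19 ((2 * n + 1) * (2 * n + 1)))
    (run_assign hM.roomy hb₂ rfl (by decide) (by rw [e₂]; omega) (by rw [e₂])) ?_
  rintro _ hb₃ - rfl
  set σ₃ := σ₂.setReg 19 ((2 * n + 1) * (2 * n + 1)) with hσ₃
  have e₃ : (lit 2 * var 19).eval σ₃ = 2 * ((2 * n + 1) * (2 * n + 1)) := by
    simp [hσ₃, State.reg_setReg]
  refine run_seq le_rfl (Q₁ := fun τ => τ = σ₃.setReg 4 (2 * ((2 * n + 1) * (2 * n + 1))))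
    (run_assign hM.roomy hb₃ rfl (by decide) (by rw [e₃]; omega) (by rw [e₃])) ?_
  rintro _ hb₄ - rfl
  set σ₄ := σ₃.setReg 4 (2 * ((2 * n + 1) * (2 * n + 1))) with hσ₄
  have e₄ : (var 0 + lit 1).eval σ₄ = n + 1 := by
    simp [hσ₄, hσ₃, hσ₂, hσ₁, State.reg_setReg, hn0]
  refine run_seq le_rfl (Q₁ := fun τ => τ = σ₄.setReg 5 (n + 1))
    (run_assign hM.roomy hb₄ rfl (by decide) (by rw [e₄]; omega) (by rw [e₄])) ?_
  rintro _ hb₅ - rfl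
  set σ₅ := σ₄.setReg 5 (n + 1) with hσ₅
  have hctx : Ctx G w σ₅ := by
    refine ⟨?_, ?_, ?_, ?_, ?_, ?_, fun v => ?_, fun u v => ?_⟩
    iterate 6 simp [hσ₅, hσ₄, hσ₃, hσ₂, hσ₁, State.reg_setReg, hn0]
    · simp [hσ₅, hσ₄, hσ₃, hσ₂, hσ₁, hσ₀, graphInput]
    · simp only [hσ₅, hσ₄, hσ₃, hσ₂, hσ₁, hσ₀, graphInput, State.arr_setReg]
      simp only [one_ne_zero, if_false, if_true]
      refine if_congr ⟨?_, fun h => ⟨u, v, h, rfl⟩⟩ rfl rfl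
      rintro ⟨u', v', h, he⟩
      obtain ⟨h1, h2⟩ := (cell_inj v.2 v'.2).1 he
      rwa [Fin.ext h1, Fin.ext h2]
  refine run_seq le_rfl (run_fill hM.roomy hb₅ (fun k => k) (fun _ => 1) hctx.order (by decide)
    rfl rfl le_rfl (fun _ _ _ _ h => h) (fun _ _ => by omega)
    (by intro k _ τ _ hi _ _; simp [hi])) ?_
  rintro σ₆ hb₆ ha₆ ⟨h₆, -⟩
  have hctx₆ := hctx.of_agreesOff ha₆ (by decide) (by decide)
  have hk₆ : σ₆.reg 1 = 0 := by
    rw [ha₆.1 1 (by decide)]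
    simp [hσ₅, hσ₄, hσ₃, hσ₂, hσ₁, State.reg_setReg, hσ₀, graphInput]
  refine (run_forLoop (T := 8000 * (2 * n + 1) ^ 5) hM.roomy hb₆
    (fun k τ => ∃ X L, X.card + k ≤ n ∧ L.length ≤ k ∧ Progress G w τ X L) hctx₆.order
    (by decide) (by decide) le_rfl ?_ ?_ ?_).mono le_rfl ?_
  · rintro k τ v ⟨X, L, h1, h2, h3⟩
    exact ⟨X, L, h1, h2, h3.remaining,
      ⟨by rw [State.reg_setReg, if_neg (by decide)]; exact h3.shown.1, h3.shown.2⟩, h3.iff⟩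
  · refine ⟨Finset.univ, [], by simp, by simp, fun v => ?_, ⟨by simp [hk₆], fun i => i.elim0⟩,
      fun L' => by simp⟩
    rw [h₆ v v.2]; simp
  · rintro k hk τ hbτ haτ - ⟨X, L, h1, h2, h3⟩
    exact run_roundCmd hM hw hbτ (hctx₆.of_agreesOff haτ (by decide) (by decide)) hk h1 h2 h3
  · rintro τ - - ⟨X, L, h1, -, h3⟩
    -- With nothing left, `Progress.iff` yields existence and uniqueness of the decomposition at
    -- once.
    have hXe : X = ∅ := Finset.card_eq_zero.1 (by omega)
    refine ⟨L, h3.shown, fun L' => ?_⟩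
    rw [h3.iff L', hXe]
    simp [isBottleneckDecomposition_empty_iff]

end RAM

theorem pow_pow_lt_pow {z : ℕ} (hz : 2 ≤ z) (a b : ℕ) : (z ^ a) ^ b < z ^ (a * b + 1) := by
  rw [← pow_mul]
  exact Nat.pow_lt_pow_right hz (Nat.lt_succ_self _)

theorem theorem3 :
    ∃ (prog : RAM.Cmd) (K c : ℕ),
      ∀ (n : ℕ) (G : SimpleGraph (Fin n)) (w : Fin n → ℕ) (U : ℕ),
        2 ≤ n → (∀ v, 0 < w v) → (∀ v, w v ≤ U) →
          ∃ (t : ℕ) (σ : RAM.State) (L : List (Finset (Fin n) × Finset (Fin n))),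
            RAM.Exec ((n * U) ^ c) prog (graphInput G w) t σ ∧
            (t : ℝ) ≤ (K : ℝ) * (n : ℝ) ^ 6 * Real.log ((n : ℝ) * (U : ℝ)) ∧
            IsBottleneckDecomposition G w Finset.univ L ∧
            (∀ L', IsBottleneckDecomposition G w Finset.univ L' → L' = L) ∧
            DisplaysPairs σ L := by
  -- The factor `3 ^ 6` comes from `2n + 1 ≤ 3n`, and the factor `2` from `log(nU) ≥ log 2 > 1/2`.
  -- With `z = nU`, all stored numbers are at most `M = z ^ 8`, and the exponent of the word bound
  -- is the least natural number for which `M ^ 128 < z ^ c`.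
  refine ⟨RAM.decompositionCmd, 2 * (9000 * 3 ^ 6), 8 * 128 + 1, ?_⟩
  intro n G w U hn hw hU
  have hU1 : 1 ≤ U := (hw ⟨0, by omega⟩).trans_le (hU _)
  set z := n * U with hz
  have hnz : n ≤ z := Nat.le_mul_of_pos_right n hU1
  have hz2 : 2 ≤ z := hn.trans hnz
  have hzM : z ≤ z ^ 8 := Nat.le_self_pow (by norm_num) z
  have hUz : U ≤ z := Nat.le_mul_of_pos_left U (by omega)
  have hWt : setWeight w Finset.univ ≤ z := by
    refine (Finset.sum_le_card_nsmul _ _ U fun v _ => hU v).trans ?_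
    simp [hz]
  have hz4 : 16 * z ^ 2 ≤ z ^ 8 := by
    have h1 : 2 ^ 4 ≤ z ^ 4 := Nat.pow_le_pow_left hz2 4
    have h2 : z ^ 4 ≤ z ^ 6 := Nat.pow_le_pow_right (by omega) (by norm_num)
    calc 16 * z ^ 2 ≤ z ^ 6 * z ^ 2 := Nat.mul_le_mul_right _ (by omega)
      _ = z ^ 8 := by ring
  have hM : RAM.Ample w (z ^ (8 * 128 + 1)) (z ^ 8) := by
    refine ⟨⟨hz2.trans hzM, ?_⟩, ?_, ?_⟩
    · exact pow_pow_lt_pow hz2 8 128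
    · nlinarith
    · have := Nat.mul_le_mul hWt hWt
      nlinarith
  have hb : RAM.Bdd (z ^ 8) (graphInput G w) := by
    constructor
    · intro x
      simp only [graphInput]
      split_ifs <;> omega
    · intro a i
      simp only [graphInput]
      split_ifs with h1 h2
      · exact (hU _).trans (hUz.trans hzM)
      all_goals omega
  obtain ⟨t, σ, hexec, ht, -, L, hshow, hL⟩ := RAM.run_decompositionCmd hM hw hb
  refine ⟨t, σ, L, hexec, ?_, (hL L).2 rfl, fun L' h => (hL L').1 h, hshow⟩
  have hlog : 1 / 2 ≤ Real.log ((n : ℝ) * (U : ℝ)) := by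
    have h1 : (2 : ℝ) ≤ (n : ℝ) * (U : ℝ) := by exact_mod_cast hz2
    have h2 := Real.log_le_log (by norm_num) h1
    have := Real.log_two_gt_d9
    linarith
  have h1 : t ≤ 9000 * 3 ^ 6 * n ^ 6 :=
    calc t ≤ 9000 * (2 * n + 1) ^ 6 := ht
      _ ≤ 9000 * (3 * n) ^ 6 := by gcongr; omega
      _ = 9000 * 3 ^ 6 * n ^ 6 := by ring
  have h2 : (t : ℝ) ≤ 9000 * 3 ^ 6 * (n : ℝ) ^ 6 := by exact_mod_cast h1
  have h3 : (0 : ℝ) ≤ 9000 * 3 ^ 6 * (n : ℝ) ^ 6 := by positivity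
  push_cast
  nlinarith
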